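/- Setting. Let $D\subset\mathbb C$ be a bounded simply connected domain. For each $\delta>0$ let $\Gamma^{\#\delta}$ be an infinite, connected, oriented planar graph without self-loops or multiple oriented edges, properly embedded in the plane (edges are simple arcs which meet only at endpoints, except that two opposite edges may be drawn as the same arc; every compact set meets finitely many vertices and edges), with a weight $w(u,v)>0$ on each oriented edge $(u,v)$. Put $q(u,v)=w(u,v)/\sum_{v'}w(u,v')$ if $(u,v)$ is an edge and $q(u,v)=0$ otherwise; these are the jump probabilities of the random walk on $\Gamma^{\#\delta}$. Assume: (Bounded density) there is a constant $C$ such that for all $\delta>0$ every ball of radius $\delta$ contains fewer than $C$ vertices of $\Gamma^{\#\delta}$. (Uniform crossing estimate) let $R=[0,3]\times[0,1]$, $B_1=B((\tfrac12,\tfrac12),\tfrac14)$, $B_2=B((\tfrac52,\tfrac12),\tfrac14)$. There are $\delta_0,\alpha_0>0$ such that for all $0<\delta<\delta_0$, $l\ge 1/\delta_0$, $z\in\mathbb C$ and every vertex $v\in l\delta B_1+z$ of $\Gamma^{\#\delta}$, the probability that the random walk from $v$ visits a vertex in $l\delta B_2+z$ before its trajectory, followed along the edges, exits $l\delta R+z$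 is larger than $\alpha_0$. The same holds with $B_1$ and $B_2$ exchanged, and for upward and downward crossings of the vertical rectangle $[0,1]\times[0,3]$ between $B_1$ and $B((\tfrac12,\tfrac52),\tfrac14)$. A rooted loop $(v_0,\dots,v_p)$, $v_p=v_0$, $p\ge1$, has mass $\frac1p\prod_{i=0}^{p-1}q(v_i,v_{i+1})$. Following the edges, each rooted loop is a closed curve; the random walk loop measure is the image of this measure on the metric space $\mathscr L$ of closed curves modulo increasing reparametrization and change of root, with the distance $d$ given by the infimum of the uniform distance over all parametrizations and roots. Let $\mu^{\#\delta}_D$ be its restriction to the set $\mathscr L_D$ of loops contained in $D$, and let the random walk loop soup (RWLS) $\mathcal L^{\#\delta}_D$ be a Poisson point process on $\mathscr L$ with intensity $\mu_D^{\#\delta}$. For $\eta>0$ let $(\partial D)^\eta$ be the set of points at distance less than $\eta$ from $\partial D$. Statement. For every $\varepsilon>0$ there is $\eta>0$ such that for all sufficiently small $\delta>0$, with probability at least $1-\varepsilon$, no loop of $\mathcal L_D^{\#\delta}$ has both distance less than $\eta$ from $\partial D$ and diameter larger than $\varepsilon$. Moreover, for every $\varepsilon>0$ there is $\eta'>0$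 such that for all sufficiently small $\delta>0$, $$\mu_D^{\#\delta}\bigl(\{l\in\mathscr L_D:\ \operatorname{diam}(l)\ge\varepsilon,\ l\cap(\partial D)^{\eta'}\ne\emptyset\}\bigr)\le\varepsilon .$$ -/

import Mathlib

open Set MeasureTheory ProbabilityTheory Topology Filter
open scoped ENNReal NNReal unitInterval

noncomputable section

/-! ## The space of unrooted, unparametrized loops -/

/-- A parametrized rooted loop in the plane, extended to the real line by periodicity:
a continuous function `ℝ → ℂ` of period one. Its root is its value at `0`. -/
structure ParamLoop where
  toFun : ℝ → ℂ
  continuous' : Continuous toFun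
  periodic' : Function.Periodic toFun 1

namespace ParamLoop

/-- The distance of two parametrized loops modulo reparametrization and change of root.
The units of `CircleDeg1Lift` are the increasing homeomorphisms `φ` of `ℝ` with
`φ (t + 1) = φ t + 1`, that is, the compositions of an increasing reparametrization of `[0, 1]`
(extended to `ℝ`) with a translation. -/
instance : EDist ParamLoop :=
  ⟨fun f g => ⨅ φ : CircleDeg1Liftˣ, ⨆ t : ℝ, edist (f.toFun t) (g.toFun (φ t))⟩

theorem edist_def (f g : ParamLoop) :
    edist f g = ⨅ φ : CircleDeg1Liftˣ, ⨆ t : ℝ, edist (f.toFun t) (g.toFun (φ t)) := rfl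

theorem edist_comm_le (f g : ParamLoop) : edist f g ≤ edist g f := by
  rw [edist_def g f]
  refine le_iInf fun φ => ?_
  rw [edist_def]
  refine (iInf_le _ φ⁻¹).trans (iSup_le fun t => ?_)
  refine le_trans (le_of_eq ?_)
    (le_iSup (fun s : ℝ => edist (g.toFun s) (f.toFun (φ s))) ((φ⁻¹ : CircleDeg1Liftˣ) t))
  rw [CircleDeg1Lift.units_apply_inv_apply, edist_comm]

instance : PseudoEMetricSpace ParamLoop where
  edist_self f := by
    refine le_antisymm ?_ zero_le
    rw [edist_def]
    exact (iInf_le _ 1).trans (iSup_le fun t => by simp)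
  edist_comm f g := le_antisymm (edist_comm_le f g) (edist_comm_le g f)
  edist_triangle f g h := by
    rw [edist_def f g, edist_def g h]
    refine ENNReal.le_iInf_add_iInf fun φ ψ => ?_
    rw [edist_def]
    refine (iInf_le _ (ψ * φ)).trans (iSup_le fun t => ?_)
    have e : ((ψ * φ : CircleDeg1Liftˣ) : CircleDeg1Lift) t = ψ (φ t) := by simp
    rw [e]
    refine (edist_triangle _ (g.toFun (φ t)) _).trans (add_le_add ?_ ?_)
    · exact le_iSup (fun s : ℝ => edist (f.toFun s) (g.toFun (φ s))) t
    · exact le_iSup (fun s : ℝ => edist (g.toFun s) (h.toFun (ψ s))) (φ t)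

theorem isClosed_range (f : ParamLoop) : IsClosed (range f.toFun) := by
  rw [← f.periodic'.image_Icc one_pos 0]
  exact (isCompact_Icc.image f.continuous').isClosed

theorem range_subset_of_edist_eq_zero {f g : ParamLoop} (h : edist f g = 0) :
    range f.toFun ⊆ range g.toFun := by
  rintro _ ⟨t, rfl⟩
  rw [← g.isClosed_range.closure_eq, EMetric.mem_closure_iff]
  intro ε hε
  have h' : edist f g < ε := h ▸ hε
  rw [edist_def, iInf_lt_iff] at h'
  obtain ⟨φ, hφ⟩ := h'
  exact ⟨_, mem_range_self _,
    (le_iSup (fun s : ℝ => edist (f.toFun s) (g.toFun (φ s))) t).trans_lt hφ⟩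

/-- The periodic extension of a closed path in the plane. -/
def ofPath {x : ℂ} (p : Path x x) : ParamLoop where
  toFun t := p.extend (Int.fract t)
  continuous' := ContinuousOn.comp_fract'' p.continuous_extend.continuousOn (by simp)
  periodic' t := by simp

end ParamLoop

/-- The metric space of unrooted loops: loops modulo reparametrization and change of root. -/
abbrev UnrootedLoop : Type := SeparationQuotient ParamLoop

instance : MeasurableSpace UnrootedLoop := borel UnrootedLoop

instance : BorelSpace UnrootedLoop := ⟨rfl⟩

/-- The set of points of the plane visited by an unrooted loop. -/
def UnrootedLoop.trace : UnrootedLoop → Set ℂ :=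
  SeparationQuotient.lift (fun f => range f.toFun) fun f g h =>
    have h0 : edist f g = 0 := EMetric.inseparable_iff.1 h
    Subset.antisymm (ParamLoop.range_subset_of_edist_eq_zero h0)
      (ParamLoop.range_subset_of_edist_eq_zero (by rwa [edist_comm] at h0))

/-- The unrooted loops that stay in `D`. -/
def loopsIn (D : Set ℂ) : Set UnrootedLoop := {l | l.trace ⊆ D}

/-! ## Weighted oriented graphs embedded in the plane -/

/-- An infinite, connected, oriented, weighted planar graph, properly embedded in the plane.
The vertices are points of the plane; `weight u v` is the weight of the oriented edge `(u, v)`,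
and it is positive exactly when `(u, v)` is an edge. For an edge `(u, v)` the curve `arc u v` is
the embedded edge; the values of `arc` at pairs which are not edges play no role. -/
structure PlanarGraph where
  verts : Set ℂ
  weight : ℂ → ℂ → ℝ≥0
  arc : ∀ u v : ℂ, Path u v
  mem_of_edge : ∀ u v, weight u v ≠ 0 → u ∈ verts ∧ v ∈ verts
  ne_of_edge : ∀ u v, weight u v ≠ 0 → u ≠ v
  infinite : verts.Infinite
  connected : ∀ u ∈ verts, ∀ v ∈ verts,
    Relation.ReflTransGen (fun a b => weight a b ≠ 0 ∨ weight b a ≠ 0) u v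
  /-- Every edge is drawn as a simple arc. -/
  arc_injective : ∀ u v, weight u v ≠ 0 → Function.Injective (arc u v)
  /-- An edge contains no vertices except its two endpoints. -/
  arc_verts : ∀ u v, weight u v ≠ 0 → range (arc u v) ∩ verts ⊆ {u, v}
  /-- Edges with different pairs of endpoints meet at most at a common endpoint. -/
  arc_inter : ∀ u v u' v', weight u v ≠ 0 → weight u' v' ≠ 0 → s(u, v) ≠ s(u', v') →
    range (arc u v) ∩ range (arc u' v') ⊆ {u, v} ∩ {u', v'}
  /-- Two opposite edges are drawn as the same arc, or meet only at their endpoints. -/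
  arc_opposite : ∀ u v, weight u v ≠ 0 → weight v u ≠ 0 →
    range (arc u v) = range (arc v u) ∨ range (arc u v) ∩ range (arc v u) ⊆ {u, v}
  /-- Properness: a compact set meets only finitely many vertices and edges. -/
  finite_verts : ∀ K : Set ℂ, IsCompact K → (verts ∩ K).Finite
  finite_edges : ∀ K : Set ℂ, IsCompact K →
    {e : ℂ × ℂ | weight e.1 e.2 ≠ 0 ∧ (range (arc e.1 e.2) ∩ K).Nonempty}.Finite

namespace PlanarGraph

variable (G : PlanarGraph)

/-- The transition probability `q(u, v) = w(u, v) / ∑ v', w(u, v')` of the random walk. -/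
def q (u v : ℂ) : ℝ≥0∞ := (G.weight u v : ℝ≥0∞) / ∑' v' : ℂ, (G.weight u v' : ℝ≥0∞)

/-- The product of the transition probabilities along the walk that goes from `u` through the
successive points of the list to `w`. -/
def walkProb (w : ℂ) : ℂ → List ℂ → ℝ≥0∞
  | u, [] => G.q u w
  | u, v :: l => G.q u v * walkProb w v l

/-- The curve obtained by following, one after the other, the edges used by the walk that goes from
`u` through the successive points of the list to `w`. -/
def walkPath (w : ℂ) : (u : ℂ) → List ℂ → Path u w
  | u, [] => G.arc u w
  | u, v :: l => (G.arc u v).trans (walkPath w v l)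

/-! ### Loop measure -/

/-- The unrooted loop traced by the rooted loop `(a, v₁, …, v_{p-1}, a)`, with
`l = [v₁, …, v_{p-1}]`, along the edges of the graph. -/
def toUnrootedLoop (a : ℂ) (l : List ℂ) : UnrootedLoop :=
  SeparationQuotient.mk (ParamLoop.ofPath (G.walkPath a a l))

/-- The rooted loop measure of the rooted loop `(a, v₁, …, v_{p-1}, a)`, with
`l = [v₁, …, v_{p-1}]`: the product of the transition probabilities divided by the length `p`. -/
def rootedMass (a : ℂ) (l : List ℂ) : ℝ≥0∞ := G.walkProb a a l / ((l.length + 1 : ℕ) : ℝ≥0∞)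

/-- The random walk loop measure: the image of the rooted loop measure on the space of unrooted
loops. -/
def loopMeasure : Measure UnrootedLoop :=
  Measure.sum fun x : ℂ × List ℂ => G.rootedMass x.1 x.2 • Measure.dirac (G.toUnrootedLoop x.1 x.2)

/-- The random walk loop measure restricted to the loops in `D`. -/
def loopMeasureIn (D : Set ℂ) : Measure UnrootedLoop := G.loopMeasure.restrict (loopsIn D)

/-! ### Crossing probabilities -/

/-- The probability that the random walk started at a vertex `v ∉ T` hits `T` before its trajectory,
followed along the edges, exits `R`: the sum, over all finite walks from `v` whose last vertex is
their first vertex in `T` and whose trajectory stays in `R`, of the probability that the random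
walk starts with this walk. -/
def hitProb (v : ℂ) (T R : Set ℂ) : ℝ≥0∞ :=
  ∑' x : {x : List ℂ × ℂ // (∀ y ∈ x.1, y ∉ T) ∧ x.2 ∈ T ∧ range (G.walkPath x.2 v x.1) ⊆ R},
    G.walkProb x.1.2 v x.1.1

/-- From each vertex in the copy `s S + z` of the starting set `S`, the random walk hits the copy
`s T + z` of the target set `T` before exiting the copy `s R + z` of `R`, with probability larger
than `α`. -/
def Crosses (S T R : Set ℂ) (s : ℝ) (z : ℂ) (α : ℝ) : Prop :=
  ∀ v ∈ G.verts, v ∈ (fun x : ℂ => (s : ℂ) * x + z) '' S →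
    ENNReal.ofReal α <
      G.hitProb v ((fun x : ℂ => (s : ℂ) * x + z) '' T) ((fun x : ℂ => (s : ℂ) * x + z) '' R)

end PlanarGraph

/-- Bounded density, for a family of graphs indexed by the mesh size `δ > 0`. -/
def BoundedDensity (Γ : ℝ → PlanarGraph) : Prop :=
  ∃ C : ℕ, ∀ δ : ℝ, 0 < δ → ∀ x : ℂ, ((Γ δ).verts ∩ Metric.ball x δ).encard < C

/-- The horizontal rectangle `[0,3] × [0,1]`. -/
def rectH : Set ℂ := Icc 0 3 ×ℂ Icc 0 1

/-- The vertical rectangle `[0,1] × [0,3]`. -/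
def rectV : Set ℂ := Icc 0 1 ×ℂ Icc 0 3

/-- The ball of radius `1/4` around `(1/2, 1/2)`, at the left end of `rectH` and at the lower end
of `rectV`. -/
def ballOne : Set ℂ := Metric.ball ⟨1 / 2, 1 / 2⟩ (1 / 4)

/-- The ball at the right end of `rectH`. -/
def ballRight : Set ℂ := Metric.ball ⟨5 / 2, 1 / 2⟩ (1 / 4)

/-- The ball at the upper end of `rectV`. -/
def ballUp : Set ℂ := Metric.ball ⟨1 / 2, 5 / 2⟩ (1 / 4)

/-- The uniform crossing estimate: horizontal rectangles of all scales `l δ` with `l ≥ 1 / δ₀` are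
crossed from left to right and from right to left, and vertical rectangles upwards and downwards,
with probability larger than `α₀`. -/
def UniformCrossing (Γ : ℝ → PlanarGraph) : Prop :=
  ∃ δ₀ α₀ : ℝ, 0 < δ₀ ∧ 0 < α₀ ∧ ∀ δ : ℝ, 0 < δ → δ < δ₀ → ∀ (z : ℂ) (l : ℝ), 1 / δ₀ ≤ l →
    (Γ δ).Crosses ballOne ballRight rectH (l * δ) z α₀ ∧
    (Γ δ).Crosses ballRight ballOne rectH (l * δ) z α₀ ∧
    (Γ δ).Crosses ballOne ballUp rectV (l * δ) z α₀ ∧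
    (Γ δ).Crosses ballUp ballOne rectV (l * δ) z α₀

/-! ## Poisson point processes -/

/-- The number of points in `A`, counted with multiplicity, of the multiset with multiplicity
function `m`. -/
def multisetCount {X : Type*} (m : X → ℕ∞) (A : Set X) : ℝ≥0∞ :=
  ∑' x : A, ENat.toENNReal (m x)

/-- The random at most countable multiset `L` of points of `X` (given through its multiplicity
function) is, under the probability measure `P`, a Poisson point process of intensity `μ`. -/
structure IsPoissonPointProcess {X Ω : Type*} [MeasurableSpace X] [MeasurableSpace Ω]
    (μ : Measure X) (P : Measure Ω) (L : Ω → X → ℕ∞) : Prop where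
  countable : ∀ ω, {x | L ω x ≠ 0}.Countable
  measurable : ∀ A, MeasurableSet A → Measurable fun ω => multisetCount (L ω) A
  /-- The number of points in a set of finite intensity has the Poisson law. -/
  poisson : ∀ A, MeasurableSet A → μ A ≠ ∞ → ∀ n : ℕ,
    P {ω | multisetCount (L ω) A = n} =
      ENNReal.ofReal (Real.exp (-(μ A).toReal) * (μ A).toReal ^ n / n.factorial)
  /-- A set of infinite intensity contains infinitely many points. -/
  infinite : ∀ A, MeasurableSet A → μ A = ∞ → ∀ᵐ ω ∂P, multisetCount (L ω) A = ∞
  /-- The numbers of points in disjoint sets are independent. -/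
  indep : ∀ (n : ℕ) (A : Fin n → Set X), (∀ i, MeasurableSet (A i)) →
    Pairwise (fun i j => Disjoint (A i) (A j)) →
    iIndepFun (fun i ω => multisetCount (L ω) (A i)) P

end

noncomputable section

/-! ## Crossing paths -/

/-! Cover `D` by finitely many balls of radius `r / 2`. A large loop in `D` that comes close to
`frontier D` visits, for some centre `x` of the cover, the set `A` of vertices in the ball around
`x` and the set `B` of vertices near the boundary but far from `x`. Rerooting such a loop at an
entrance into `A` that follows a visit to `B` absorbs the factor `1 / p` of the loop measure
(`tsum_rotate_div_length_le`, `tsum_cycleWeight_le`). The mass is then at most the sum over `u ∈ A`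
of the expected number of such entrances at `u`, for the walk started at `u` itself.

In this diagonal sum the starting point varies with `u`. The Harnack inequality
(`CrossingEstimate.harnack`) replaces all starting points by one `u₀`, at the cost of a constant,
and the sum becomes the expected total number of entrances for a single walk. If `p` now bounds the
probability of reaching `A` from `B` before being killed, a geometric series bounds this number by a
multiple of `p`. The walk is killed on leaving `D`, except in a ball around `x`: there the entrance
counts have to be harmonic even if the ball sticks out of `D`. Loops in `D` keep their weight.

That `p` is small is a Beurling type estimate: at each of `k` scales around a boundary point the
walk has a fixed chance of leaving `D`, so `p ≤ (1 - a ^ 82) ^ k`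
(`CrossingEstimate.le_pow_of_blocked`).

Both estimates combine the crossing hypothesis with plane topology. A path separates the ends of
some rectangle of its own size (`exists_corridor_of_path`), and since edges meet only at endpoints,
a walk crossing the rectangle shares a vertex with a path of edges. For the Harnack inequality the
path runs through vertices where the function is large. For the boundary estimate, crossings inside
`D` of all rectangles around a point outside `D` would form a circuit around it, which a simply
connected `D` excludes (`exists_blocked_corridor`). Finally, a Poisson process of mass at most `ε`
is empty with probability at least `1 - ε`. -/

theorem mem_Ioo_of_isPreconnected {X : Type*} [TopologicalSpace X] {S : Set X} {θ : X → ℝ}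
    (hS : IsPreconnected S) (hθ : ContinuousOn θ S) {lo hi : ℝ} (hlo : ∀ x ∈ S, θ x ≠ lo)
    (hhi : ∀ x ∈ S, θ x ≠ hi) {x y : X} (hx : x ∈ S) (hxI : θ x ∈ Ioo lo hi) (hy : y ∈ S) :
    θ y ∈ Ioo lo hi := by
  have hc : OrdConnected (θ '' S) := (hS.image θ hθ).ordConnected
  have hout := hc.out (mem_image_of_mem θ hx) (mem_image_of_mem θ hy)
  have hout' := hc.out (mem_image_of_mem θ hy) (mem_image_of_mem θ hx)
  refine ⟨?_, ?_⟩
  · by_contra! h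
    obtain ⟨z, hz, hz'⟩ := hout' ⟨h, hxI.1.le⟩
    exact hlo z hz hz'
  · by_contra! h
    obtain ⟨z, hz, hz'⟩ := hout ⟨hxI.2.le, h⟩
    exact hhi z hz hz'

/-- A continuous angle cannot be defined along a closed chain of four connected sets which lie
successively above, to the left of, below and to the right of the origin. -/
theorem false_of_quadrant_chain {X : Type*} [TopologicalSpace X] {T L B R : Set X} {θ : X → ℝ}
    (hT : IsPreconnected T) (hL : IsPreconnected L) (hB : IsPreconnected B)
    (hR : IsPreconnected R) (cT : ContinuousOn θ T) (cL : ContinuousOn θ L)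
    (cB : ContinuousOn θ B) (cR : ContinuousOn θ R)
    (sT : ∀ x ∈ T, 0 ≤ Real.sin (θ x)) (sL : ∀ x ∈ L, Real.cos (θ x) < 0)
    (sB : ∀ x ∈ B, Real.sin (θ x) ≤ 0) (sR : ∀ x ∈ R, 0 < Real.cos (θ x))
    (hTL : (T ∩ L).Nonempty) (hLB : (L ∩ B).Nonempty) (hBR : (B ∩ R).Nonempty)
    (hRT : (R ∩ T).Nonempty) : False := by
  obtain ⟨x₁, h₁T, h₁L⟩ := hTL
  obtain ⟨x₂, h₂L, h₂B⟩ := hLB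
  obtain ⟨x₃, h₃B, h₃R⟩ := hBR
  obtain ⟨x₄, h₄R, h₄T⟩ := hRT
  have hπ := Real.pi_pos
  -- After this normalization `θ x₁ ≤ π`. Going once around the chain forces `θ x₂ ≥ π`, `θ x₃ >
  -- 3π/2`, `θ x₄ ≥ 2π`, and then `θ x₁ > 3π/2`: the angle has gained a turn. Each set confines the
  -- angle to an interval of length `2π`, because it avoids the angles of the opposite direction.
  wlog h0 : θ x₁ ∈ Ico 0 (2 * Real.pi) generalizing θ
  · obtain ⟨k, hk, -⟩ := existsUnique_sub_zsmul_mem_Ico Real.two_pi_pos (θ x₁) 0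
    refine this (θ := fun x => θ x - k * (2 * Real.pi)) (by fun_prop) (by fun_prop) (by fun_prop)
      (by fun_prop) ?_ ?_ ?_ ?_ (by simpa using hk)
    · simpa only [Real.sin_sub_int_mul_two_pi] using sT
    · simpa only [Real.cos_sub_int_mul_two_pi] using sL
    · simpa only [Real.sin_sub_int_mul_two_pi] using sB
    · simpa only [Real.cos_sub_int_mul_two_pi] using sR
  have s1 : Real.sin (Real.pi * (3 / 2)) = -1 := by
    rw [show Real.pi * (3 / 2) = Real.pi / 2 + Real.pi by ring, Real.sin_add_pi, Real.sin_pi_div_two]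
  have s2 : Real.sin (Real.pi * (7 / 2)) = -1 := by
    rw [show Real.pi * (7 / 2) = Real.pi * (3 / 2) + 2 * Real.pi by ring, Real.sin_add_two_pi, s1]
  have s3 : Real.sin (Real.pi * (5 / 2)) = 1 := by
    rw [show Real.pi * (5 / 2) = Real.pi / 2 + 2 * Real.pi by ring, Real.sin_add_two_pi,
      Real.sin_pi_div_two]
  have s4 : Real.cos (Real.pi * 3) = -1 := by
    rw [show Real.pi * 3 = Real.pi + 2 * Real.pi by ring, Real.cos_add_two_pi, Real.cos_pi]
  have hle : θ x₁ ≤ Real.pi := by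
    by_contra! h
    have := Real.sin_neg_of_neg_of_neg_pi_lt (x := θ x₁ - 2 * Real.pi) (by linarith [h0.2])
      (by linarith)
    rw [Real.sin_sub_two_pi] at this
    linarith [sT _ h₁T]
  have hne : θ x₁ ≠ 0 := fun h => by
    have := sL _ h₁L
    rw [h, Real.cos_zero] at this
    linarith
  have e1 : θ x₁ ∈ Ioo 0 (2 * Real.pi) := ⟨lt_of_le_of_ne h0.1 hne.symm, h0.2⟩
  have e2 := mem_Ioo_of_isPreconnected hL cL
    (fun x hx h => by have := sL x hx; rw [h, Real.cos_zero] at this; linarith)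
    (fun x hx h => by have := sL x hx; rw [h, Real.cos_two_pi] at this; linarith) h₁L e1 h₂L
  have e2' : Real.pi ≤ θ x₂ := by
    by_contra! h
    linarith [sB _ h₂B, Real.sin_pos_of_pos_of_lt_pi e2.1 h]
  have e3 := mem_Ioo_of_isPreconnected hB cB (lo := Real.pi / 2) (hi := Real.pi * (5 / 2))
    (fun x hx h => by have := sB x hx; rw [h, Real.sin_pi_div_two] at this; linarith)
    (fun x hx h => by have := sB x hx; rw [h, s3] at this; linarith) h₂B
    ⟨by linarith, by linarith [e2.2]⟩ h₃B
  have e3' : Real.pi * (3 / 2) < θ x₃ := by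
    by_contra! h
    linarith [sR _ h₃R, Real.cos_nonpos_of_pi_div_two_le_of_le e3.1.le (by linarith)]
  have e4 := mem_Ioo_of_isPreconnected hR cR (lo := Real.pi) (hi := Real.pi * 3)
    (fun x hx h => by have := sR x hx; rw [h, Real.cos_pi] at this; linarith)
    (fun x hx h => by have := sR x hx; rw [h, s4] at this; linarith) h₃R
    ⟨by linarith, by linarith [e3.2]⟩ h₄R
  have e4' : 2 * Real.pi ≤ θ x₄ := by
    by_contra! h
    have := Real.sin_neg_of_neg_of_neg_pi_lt (x := θ x₄ - 2 * Real.pi) (by linarith)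
      (by linarith [e4.1])
    rw [Real.sin_sub_two_pi] at this
    linarith [sT _ h₄T]
  have e5 := mem_Ioo_of_isPreconnected hT cT (lo := Real.pi * (3 / 2)) (hi := Real.pi * (7 / 2))
    (fun x hx h => by have := sT x hx; rw [h, s1] at this; linarith)
    (fun x hx h => by have := sT x hx; rw [h, s2] at this; linarith) h₄T
    ⟨by linarith, by linarith [e4.2]⟩ h₁T
  linarith [e5.1]

/-- A path from left to right and a path from bottom to top intersect. -/
theorem Path.meet_of_cross {a b c d : ℂ} (γ : Path a b) (τ : Path c d)
    (h₁ : ∀ x ∈ range τ, a.re < x.re) (h₂ : ∀ x ∈ range τ, x.re < b.re)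
    (h₃ : ∀ x ∈ range γ, c.im ≤ x.im) (h₄ : ∀ x ∈ range γ, x.im ≤ d.im) :
    (range γ ∩ range τ).Nonempty := by
  by_contra hne
  have hdis : ∀ x ∈ range γ, ∀ y ∈ range τ, x ≠ y := fun x hx y hy h => hne ⟨x, hx, h ▸ hy⟩
  have mγ : ∀ t, γ.extend t ∈ range γ := fun t => ⟨projIcc 0 1 zero_le_one t, rfl⟩
  have mτ : ∀ t, τ.extend t ∈ range τ := fun t => ⟨projIcc 0 1 zero_le_one t, rfl⟩
  -- If the paths were disjoint, `F` would have a continuous logarithm on the plane. On the four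
  -- lines through the sides of the parameter square, the hypotheses put `F` in the upper, left,
  -- lower and right half-plane in turn.
  let F : ℝ × ℝ → ℂ := fun p => γ.extend p.1 - τ.extend p.2
  have hF : Continuous F := by
    have := γ.continuous_extend
    have := τ.continuous_extend
    fun_prop
  have hsc : IsSimplyConnected (univ : Set (ℝ × ℝ)) := by
    have : ContractibleSpace (univ : Set (ℝ × ℝ)) := convex_univ.contractibleSpace univ_nonempty
    exact inferInstanceAs (SimplyConnectedSpace (univ : Set (ℝ × ℝ)))
  obtain ⟨l, hlc, hl⟩ := Complex.exists_continuousOn_eqOn_exp_comp hsc isOpen_univ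
    hF.continuousOn (by
      rintro ⟨p, -, hp⟩
      exact hdis _ (mγ p.1) _ (mτ p.2) (sub_eq_zero.1 hp))
  have hl' : ∀ p, F p = Complex.exp (l p) := fun p => (hl (mem_univ p)).symm
  have him : ∀ p, Real.exp (l p).re * Real.sin (l p).im = (γ.extend p.1).im - (τ.extend p.2).im :=
    fun p => by rw [← Complex.exp_im, ← hl']; simp [F]
  have hre : ∀ p, Real.exp (l p).re * Real.cos (l p).im = (γ.extend p.1).re - (τ.extend p.2).re :=
    fun p => by rw [← Complex.exp_re, ← hl']; simp [F]
  have hlc' : Continuous fun p => (l p).im :=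
    Complex.continuous_im.comp (continuousOn_univ.1 hlc)
  have pv : ∀ s : ℝ, IsPreconnected {p : ℝ × ℝ | p.1 = s} := fun s => by
    have : {p : ℝ × ℝ | p.1 = s} = {s} ×ˢ univ := by ext; simp
    rw [this]; exact isPreconnected_singleton.prod isPreconnected_univ
  have ph : ∀ s : ℝ, IsPreconnected {p : ℝ × ℝ | p.2 = s} := fun s => by
    have : {p : ℝ × ℝ | p.2 = s} = univ ×ˢ {s} := by ext; simp
    rw [this]; exact isPreconnected_univ.prod isPreconnected_singleton
  refine false_of_quadrant_chain (θ := fun p => (l p).im) (ph 0) (pv 0) (ph 1) (pv 1)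
    hlc'.continuousOn hlc'.continuousOn hlc'.continuousOn hlc'.continuousOn ?_ ?_ ?_ ?_
    ⟨(0, 0), by simp⟩ ⟨(0, 1), by simp⟩ ⟨(1, 1), by simp⟩ ⟨(1, 0), by simp⟩
  · rintro ⟨s, t⟩ rfl
    have h := him (s, 0)
    rw [τ.extend_zero] at h
    exact nonneg_of_mul_nonneg_right (h ▸ sub_nonneg.2 (h₃ _ (mγ s))) (Real.exp_pos _)
  · rintro ⟨s, t⟩ rfl
    have h := hre (0, t)
    rw [γ.extend_zero] at h
    exact neg_of_mul_neg_right (h ▸ sub_neg.2 (h₁ _ (mτ t))) (Real.exp_pos _).le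
  · rintro ⟨s, t⟩ rfl
    have h := him (s, 1)
    rw [τ.extend_one] at h
    exact nonpos_of_mul_nonpos_right (h ▸ sub_nonpos.2 (h₄ _ (mγ s))) (Real.exp_pos _)
  · rintro ⟨s, t⟩ rfl
    have h := hre (1, t)
    rw [γ.extend_one] at h
    exact (mul_pos_iff_of_pos_left (Real.exp_pos _)).1 (h ▸ sub_pos.2 (h₂ _ (mτ t)))

/-- Like `Path.meet_of_cross`, with strict inequalities for the imaginary parts. -/
theorem Path.meet_of_cross' {a b c d : ℂ} (γ : Path a b) (τ : Path c d)
    (h₁ : ∀ x ∈ range γ, c.im < x.im) (h₂ : ∀ x ∈ range γ, x.im < d.im)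
    (h₃ : ∀ x ∈ range τ, a.re ≤ x.re) (h₄ : ∀ x ∈ range τ, x.re ≤ b.re) :
    (range γ ∩ range τ).Nonempty := by
  let f : ℂ → ℂ := fun z => ⟨z.im, z.re⟩
  have hf : Continuous f := by
    have : f = fun z : ℂ => (z.im : ℂ) + z.re * Complex.I := by
      funext z; apply Complex.ext <;> simp [f]
    rw [this]; fun_prop
  have hr : ∀ {x y : ℂ} (p : Path x y), range (p.map hf) = f '' range p := fun p => by
    rw [← range_comp]; rfl
  obtain ⟨z, hz, hz'⟩ := Path.meet_of_cross (τ.map hf) (γ.map hf)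
    (by rw [hr]; rintro _ ⟨x, hx, rfl⟩; exact h₁ x hx)
    (by rw [hr]; rintro _ ⟨x, hx, rfl⟩; exact h₂ x hx)
    (by rw [hr]; rintro _ ⟨x, hx, rfl⟩; exact h₃ x hx)
    (by rw [hr]; rintro _ ⟨x, hx, rfl⟩; exact h₄ x hx)
  rw [hr] at hz hz'
  obtain ⟨x, hx, rfl⟩ := hz
  obtain ⟨y, hy, hxy⟩ := hz'
  have : y = x := by
    have e1 := congrArg Complex.re hxy
    have e2 := congrArg Complex.im hxy
    exact Complex.ext e2 e1
  exact ⟨x, this ▸ hy, hx⟩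

/-! ## Corridors -/

/-- The rectangle of length `3 s` and width `s` centred at `m`, whose long side has the
direction `e`. -/
def corridor (e m : ℂ) (s : ℝ) : Set ℂ :=
  {x | |((x - m) * (starRingEnd ℂ) e).re| ≤ 3 / 2 * s ∧ |((x - m) * (starRingEnd ℂ) e).im| ≤ s / 2}

/-- The ball, inside the corridor, at which the crossings of the corridor start. -/
def corridorStart (e m : ℂ) (s : ℝ) : Set ℂ := Metric.ball (m - s * e) (s / 4)

/-- The ball, inside the corridor, at which the crossings of the corridor end. -/
def corridorEnd (e m : ℂ) (s : ℝ) : Set ℂ := Metric.ball (m + s * e) (s / 4)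

theorem mem_corridor_one {m x : ℂ} {s : ℝ} :
    x ∈ corridor 1 m s ↔ |x.re - m.re| ≤ 3 / 2 * s ∧ |x.im - m.im| ≤ s / 2 := by
  simp [corridor]

theorem mem_corridor_I {m x : ℂ} {s : ℝ} :
    x ∈ corridor Complex.I m s ↔ |x.im - m.im| ≤ 3 / 2 * s ∧ |x.re - m.re| ≤ s / 2 := by
  have : |-x.re + m.re| = |x.re - m.re| := by rw [abs_sub_comm]; congr 1; ring
  simp [corridor, abs_sub_comm]

theorem dist_le_of_mem_corridor {e m x : ℂ} {s : ℝ} (he : ‖e‖ = 1) (h : x ∈ corridor e m s) :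
    ‖x - m‖ ≤ 2 * s := by
  calc ‖x - m‖ = ‖(x - m) * (starRingEnd ℂ) e‖ := by simp [he]
    _ ≤ |((x - m) * (starRingEnd ℂ) e).re| + |((x - m) * (starRingEnd ℂ) e).im| :=
      Complex.norm_le_abs_re_add_abs_im _
    _ ≤ 2 * s := by linarith [h.1, h.2]

theorem re_lt_of_mem_ball {a c : ℂ} {r : ℝ} (h : a ∈ Metric.ball c r) :
    |a.re - c.re| < r := by
  rw [mem_ball_iff_norm] at h
  exact (Complex.abs_re_le_norm (a - c)).trans_lt h

theorem im_lt_of_mem_ball {a c : ℂ} {r : ℝ} (h : a ∈ Metric.ball c r) :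
    |a.im - c.im| < r := by
  rw [mem_ball_iff_norm] at h
  exact (Complex.abs_im_le_norm (a - c)).trans_lt h

/-- A path of diameter comparable to `r` separates the two ends of some corridor of comparable
size nearby. -/
theorem exists_corridor_of_path {u w : ℂ} (c : Path u w) {r : ℝ} (hr : 0 < r)
    (hw : r ≤ ‖w - u‖) :
    ∃ (e m : ℂ) (s : ℝ), (e = 1 ∨ e = Complex.I) ∧ r / 2 ≤ s ∧ s ≤ 2 * r ∧ ‖m - u‖ ≤ 2 * r ∧
      ∀ {a b : ℂ} (γ : Path a b), a ∈ corridorStart e m s → b ∈ corridorEnd e m s →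
        range γ ⊆ corridor e m s → (range γ ∩ range c).Nonempty := by
  have hf : Continuous fun t : I => ‖c t - u‖ := by fun_prop
  -- the first exit time of the ball of radius `r`
  have hK : IsCompact {t : I | ‖c t - u‖ = r} := (isClosed_eq hf continuous_const).isCompact
  have hivt : ∀ t : I, r ≤ ‖c t - u‖ → ∃ t' ≤ t, ‖c t' - u‖ = r := fun t ht => by
    obtain ⟨t', h, h'⟩ := intermediate_value_Icc (unitInterval.nonneg' (t := t)) hf.continuousOn
      (show r ∈ Icc _ _ from ⟨by simp [hr.le], ht⟩)
    exact ⟨t', h.2, h'⟩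
  obtain ⟨t₀, -, ht₀⟩ := hivt 1 (by simpa using hw)
  obtain ⟨T, hT, hTl⟩ := hK.exists_isLeast ⟨t₀, ht₀⟩
  have hle : ∀ t ∈ Icc 0 T, ‖c t - u‖ ≤ r := fun t ht => by
    by_contra! h
    obtain ⟨t', h', h''⟩ := hivt t h.le
    have : t = T := le_antisymm ht.2 ((hTl h'').trans h')
    rw [this, hT] at h
    exact lt_irrefl _ h
  have hJ : IsCompact (Icc 0 T) := isCompact_Icc
  have hJ0 : (0 : I) ∈ Icc 0 T := ⟨le_rfl, unitInterval.nonneg'⟩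
  have hJT : T ∈ Icc 0 T := ⟨unitInterval.nonneg', le_rfl⟩
  have cre : ContinuousOn (fun t => (c t).re) (Icc 0 T) := by
    have := Complex.continuous_re.comp c.continuous
    exact this.continuousOn
  have cim : ContinuousOn (fun t => (c t).im) (Icc 0 T) := by
    have := Complex.continuous_im.comp c.continuous
    exact this.continuousOn
  obtain ⟨a₁, ha₁, hx₁⟩ := hJ.exists_isMinOn ⟨0, hJ0⟩ cre
  obtain ⟨a₂, ha₂, hx₂⟩ := hJ.exists_isMaxOn ⟨0, hJ0⟩ cre
  obtain ⟨b₁, hb₁, hy₁⟩ := hJ.exists_isMinOn ⟨0, hJ0⟩ cim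
  obtain ⟨b₂, hb₂, hy₂⟩ := hJ.exists_isMaxOn ⟨0, hJ0⟩ cim
  rw [isMinOn_iff] at hx₁ hy₁
  rw [isMaxOn_iff] at hx₂ hy₂
  have bre : ∀ t ∈ Icc 0 T, |(c t).re - u.re| ≤ r := fun t ht =>
    (Complex.abs_re_le_norm (c t - u)).trans (hle t ht)
  have bim : ∀ t ∈ Icc 0 T, |(c t).im - u.im| ≤ r := fun t ht =>
    (Complex.abs_im_le_norm (c t - u)).trans (hle t ht)
  have A₁ := abs_le.1 (bre a₁ ha₁)
  have A₂ := abs_le.1 (bre a₂ ha₂)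
  have B₁ := abs_le.1 (bim b₁ hb₁)
  have B₂ := abs_le.1 (bim b₂ hb₂)
  have hu1 := hx₁ 0 hJ0
  have hu2 := hx₂ 0 hJ0
  have hu3 := hy₁ 0 hJ0
  have hu4 := hy₂ 0 hJ0
  have hT1 := hx₁ T hJT
  have hT2 := hx₂ T hJT
  have hT3 := hy₁ T hJT
  have hT4 := hy₂ T hJT
  simp only [Path.source] at hu1 hu2 hu3 hu4
  have hsum : r ≤ ((c a₂).re - (c a₁).re) + ((c b₂).im - (c b₁).im) := by
    have h1 : ‖c T - u‖ = r := hT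
    have h2 := Complex.norm_le_abs_re_add_abs_im (c T - u)
    have h3 : |(c T - u).re| ≤ (c a₂).re - (c a₁).re := by
      rw [Complex.sub_re, abs_le]; constructor <;> linarith
    have h4 : |(c T - u).im| ≤ (c b₂).im - (c b₁).im := by
      rw [Complex.sub_im, abs_le]; constructor <;> linarith
    linarith
  let m : ℂ := ⟨((c a₁).re + (c a₂).re) / 2, ((c b₁).im + (c b₂).im) / 2⟩
  have hm : ‖m - u‖ ≤ 2 * r := by
    have h2 := Complex.norm_le_abs_re_add_abs_im (m - u)
    have h3 : |(m - u).re| ≤ r := by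
      simp only [m, Complex.sub_re, abs_le]; constructor <;> linarith
    have h4 : |(m - u).im| ≤ r := by
      simp only [m, Complex.sub_im, abs_le]; constructor <;> linarith
    linarith
  have hsub : ∀ {s t : I}, s ∈ Icc 0 T → t ∈ Icc 0 T → ∀ x ∈ range (c.subpath s t),
      ∃ v ∈ Icc 0 T, c v = x := fun {s t} hs ht x hx => by
    rw [Path.range_subpath] at hx
    obtain ⟨v, hv, rfl⟩ := hx
    exact ⟨v, (ordConnected_Icc.uIcc_subset hs ht) hv, rfl⟩
  have hsub' : ∀ {s t : I}, range (c.subpath s t) ⊆ range c := fun {s t} => by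
    rw [Path.range_subpath]; exact image_subset_range _ _
  -- The piece of `c` up to time `T` reaches distance `r`, so the longer side `s` of its bounding
  -- box is at least `r / 2`. The corridor is centred on the box, perpendicular to that side, and
  -- has width `s`. Its end balls lie beyond the box, since `s - s / 4 > s / 2`, so a crossing has
  -- to meet the part of `c` joining the two extreme points.
  rcases le_total ((c b₂).im - (c b₁).im) ((c a₂).re - (c a₁).re) with hcase | hcase
  · refine ⟨Complex.I, m, (c a₂).re - (c a₁).re, Or.inr rfl, by linarith, by linarith, hm, ?_⟩
    intro a b γ ha hb hγ
    have ha' := abs_lt.1 (im_lt_of_mem_ball ha)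
    have hb' := abs_lt.1 (im_lt_of_mem_ball hb)
    simp [m] at ha' hb'
    obtain ⟨x, hx, hx'⟩ := Path.meet_of_cross' (c.subpath a₁ a₂) γ
      (fun x hx => by
        obtain ⟨v, hv, rfl⟩ := hsub ha₁ ha₂ x hx
        have := hy₁ v hv
        linarith)
      (fun x hx => by
        obtain ⟨v, hv, rfl⟩ := hsub ha₁ ha₂ x hx
        have := hy₂ v hv
        linarith)
      (fun x hx => by
        have := abs_le.1 (mem_corridor_I.1 (hγ hx)).2
        simp only [m] at this
        linarith)
      (fun x hx => by
        have := abs_le.1 (mem_corridor_I.1 (hγ hx)).2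
        simp only [m] at this
        linarith)
    exact ⟨x, hx', hsub' hx⟩
  · refine ⟨1, m, (c b₂).im - (c b₁).im, Or.inl rfl, by linarith, by linarith, hm, ?_⟩
    intro a b γ ha hb hγ
    have ha' := abs_lt.1 (re_lt_of_mem_ball ha)
    have hb' := abs_lt.1 (re_lt_of_mem_ball hb)
    simp [m] at ha' hb'
    obtain ⟨x, hx, hx'⟩ := Path.meet_of_cross γ (c.subpath b₁ b₂)
      (fun x hx => by
        obtain ⟨v, hv, rfl⟩ := hsub hb₁ hb₂ x hx
        have := hx₁ v hv
        linarith)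
      (fun x hx => by
        obtain ⟨v, hv, rfl⟩ := hsub hb₁ hb₂ x hx
        have := hx₂ v hv
        linarith)
      (fun x hx => by
        have := abs_le.1 (mem_corridor_one.1 (hγ hx)).2
        simp only [m] at this
        linarith)
      (fun x hx => by
        have := abs_le.1 (mem_corridor_one.1 (hγ hx)).2
        simp only [m] at this
        linarith)
    exact ⟨x, hx, hsub' hx'⟩

/-- Crossings of a horizontal and of a vertical corridor with nearly the same centre
intersect. -/
theorem corridor_crossings_meet {m m' : ℂ} {s : ℝ} (h₁ : |m.re - m'.re| ≤ s / 4)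
    (h₂ : |m.im - m'.im| ≤ s / 4) {a b a' b' : ℂ} (γ : Path a b) (γ' : Path a' b')
    (ha : a ∈ corridorStart 1 m s) (hb : b ∈ corridorEnd 1 m s) (hγ : range γ ⊆ corridor 1 m s)
    (ha' : a' ∈ corridorStart Complex.I m' s) (hb' : b' ∈ corridorEnd Complex.I m' s)
    (hγ' : range γ' ⊆ corridor Complex.I m' s) : (range γ ∩ range γ').Nonempty := by
  have e1 := abs_lt.1 (re_lt_of_mem_ball ha)
  have e2 := abs_lt.1 (re_lt_of_mem_ball hb)
  have e3 := abs_lt.1 (im_lt_of_mem_ball ha')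
  have e4 := abs_lt.1 (im_lt_of_mem_ball hb')
  simp at e1 e2 e3 e4
  rw [abs_le] at h₁ h₂
  -- The crossings end at distance more than `3 / 4 * s` from their centre along the corridor, and
  -- each corridor has half-width `s / 2`. An offset of `s / 4` between the centres is just
  -- affordable.
  refine Path.meet_of_cross γ γ' (fun x hx => ?_) (fun x hx => ?_) (fun x hx => ?_)
    (fun x hx => ?_)
  · have := abs_le.1 (mem_corridor_I.1 (hγ' hx)).2
    linarith
  · have := abs_le.1 (mem_corridor_I.1 (hγ' hx)).2
    linarith
  · have := abs_le.1 (mem_corridor_one.1 (hγ hx)).2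
    linarith
  · have := abs_le.1 (mem_corridor_one.1 (hγ hx)).2
    linarith

/-- A simply connected open set `D` does not contain a family of connected sets which, indexed by
the points of a square in the lattice, stay close to these points and meet whenever the indices are
neighbours, if the centre of the square is not in `D`. -/
theorem false_of_square_of_sets {D : Set ℂ} (hDo : IsOpen D) (hDs : IsSimplyConnected D) {x : ℂ}
    (hx : x ∉ D) {W : ℝ} (hW : 0 < W) {S : ℤ → ℤ → Set ℂ}
    (hSD : ∀ i j, i ∈ Icc (-16) 16 → j ∈ Icc (-16) 16 → S i j ⊆ D)
    (hSc : ∀ i j, i ∈ Icc (-16) 16 → j ∈ Icc (-16) 16 → IsPreconnected (S i j))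
    (hne : ∀ i j, i ∈ Icc (-16) 16 → j ∈ Icc (-16) 16 → (S i j).Nonempty)
    (hmeet : ∀ i j i' j', i ∈ Icc (-16) 16 → j ∈ Icc (-16) 16 → i' ∈ Icc (-16) 16 →
      j' ∈ Icc (-16) 16 → |i - i'| + |j - j'| = 1 → (S i j ∩ S i' j').Nonempty)
    (hloc : ∀ i j, i ∈ Icc (-16) 16 → j ∈ Icc (-16) 16 → ∀ z ∈ S i j,
      |z.re - (x.re + W / 4 * i)| ≤ 3 / 2 * W ∧ |z.im - (x.im + W / 4 * j)| ≤ 3 / 2 * W) :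
    False := by
  -- As `x ∉ D`, the angle around `x` has a continuous branch on `D`. The sides of the square are at
  -- distance `16 * (W / 4) = 4 * W` from `x` and the sets stray by at most `3 / 2 * W`, so the
  -- unions along the sides stay in the four half-planes.
  obtain ⟨l, hlc, hl⟩ := Complex.exists_continuousOn_eqOn_exp_comp hDs hDo
    (g := fun z => z - x) (by fun_prop) (by
      rintro ⟨z, hz, hz'⟩
      exact hx (sub_eq_zero.1 hz' ▸ hz))
  have hl' : ∀ z ∈ D, Complex.exp (l z) = z - x := fun z hz => hl hz
  have him : ∀ z ∈ D, Real.exp (l z).re * Real.sin (l z).im = z.im - x.im :=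
    fun z hz => by rw [← Complex.exp_im, hl' z hz, Complex.sub_im]
  have hre : ∀ z ∈ D, Real.exp (l z).re * Real.cos (l z).im = z.re - x.re :=
    fun z hz => by rw [← Complex.exp_re, hl' z hz, Complex.sub_re]
  have hθ : ContinuousOn (fun z => (l z).im) D := Complex.continuous_im.comp_continuousOn hlc
  have hp : (16 : ℤ) ∈ Icc (-16 : ℤ) 16 := by simp
  have hn : (-16 : ℤ) ∈ Icc (-16 : ℤ) 16 := by simp
  have hrow : ∀ j ∈ Icc (-16 : ℤ) 16, IsPreconnected (⋃ i ∈ Icc (-16 : ℤ) 16, S i j) := fun j hj =>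
    IsPreconnected.biUnion_of_chain ordConnected_Icc (fun i hi => hSc i j hi hj)
      fun i hi hi' => hmeet _ _ _ _ hi hj hi' hj (by simp)
  have hcol : ∀ i ∈ Icc (-16 : ℤ) 16, IsPreconnected (⋃ j ∈ Icc (-16 : ℤ) 16, S i j) := fun i hi =>
    IsPreconnected.biUnion_of_chain ordConnected_Icc (fun j hj => hSc i j hi hj)
      fun j hj hj' => hmeet _ _ _ _ hi hj hi hj' (by simp)
  have hrD : ∀ j ∈ Icc (-16 : ℤ) 16, (⋃ i ∈ Icc (-16 : ℤ) 16, S i j) ⊆ D := fun j hj =>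
    iUnion₂_subset fun i hi => hSD i j hi hj
  have hcD : ∀ i ∈ Icc (-16 : ℤ) 16, (⋃ j ∈ Icc (-16 : ℤ) 16, S i j) ⊆ D := fun i hi =>
    iUnion₂_subset fun j hj => hSD i j hi hj
  have hcorner : ∀ i j, i ∈ Icc (-16) 16 → j ∈ Icc (-16) 16 →
      ((⋃ i ∈ Icc (-16 : ℤ) 16, S i j) ∩ (⋃ j ∈ Icc (-16 : ℤ) 16, S i j)).Nonempty := by
    intro i j hi hj
    obtain ⟨z, hz⟩ := hne i j hi hj
    exact ⟨z, mem_iUnion₂_of_mem hi hz, mem_iUnion₂_of_mem hj hz⟩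
  refine false_of_quadrant_chain (θ := fun z => (l z).im) (hrow 16 hp) (hcol (-16) hn)
    (hrow (-16) hn) (hcol 16 hp) (hθ.mono (hrD _ hp)) (hθ.mono (hcD _ hn)) (hθ.mono (hrD _ hn))
    (hθ.mono (hcD _ hp)) ?_ ?_ ?_ ?_ (hcorner _ _ hn hp)
    (inter_comm _ _ ▸ hcorner _ _ hn hn) (hcorner _ _ hp hn) (inter_comm _ _ ▸ hcorner _ _ hp hp)
  · intro z hz
    have h := him z (hrD _ hp hz)
    obtain ⟨i, hi, hz⟩ := mem_iUnion₂.1 hz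
    have := abs_le.1 (hloc i 16 hi hp z hz).2
    push_cast at this
    refine nonneg_of_mul_nonneg_right (by rw [h]; linarith) (Real.exp_pos _)
  · intro z hz
    have h := hre z (hcD _ hn hz)
    obtain ⟨j, hj, hz⟩ := mem_iUnion₂.1 hz
    have := abs_le.1 (hloc (-16) j hn hj z hz).1
    push_cast at this
    refine neg_of_mul_neg_right (by rw [h]; linarith) (Real.exp_pos _).le
  · intro z hz
    have h := him z (hrD _ hn hz)
    obtain ⟨i, hi, hz⟩ := mem_iUnion₂.1 hz
    have := abs_le.1 (hloc i (-16) hi hn z hz).2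
    push_cast at this
    refine nonpos_of_mul_nonpos_right (by rw [h]; linarith) (Real.exp_pos _)
  · intro z hz
    have h := hre z (hcD _ hp hz)
    obtain ⟨j, hj, hz⟩ := mem_iUnion₂.1 hz
    have := abs_le.1 (hloc 16 j hp hj z hz).1
    push_cast at this
    refine (mul_pos_iff_of_pos_left (Real.exp_pos _)).1 (by rw [h]; linarith)

/-- Around a point of the complement of a simply connected open set, at each scale some corridor
cannot be crossed inside the set. -/
theorem exists_blocked_corridor {D : Set ℂ} (hDo : IsOpen D) (hDs : IsSimplyConnected D) {x : ℂ}
    (hx : x ∉ D) {W : ℝ} (hW : 0 < W) :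
    ∃ e m : ℂ, (e = 1 ∨ e = Complex.I) ∧ ‖m - x‖ ≤ 8 * W ∧
      ∀ {a b : ℂ} (γ : Path a b), a ∈ corridorStart e m W → b ∈ corridorEnd e m W →
        range γ ⊆ corridor e m W → ¬ range γ ⊆ D := by
  by_contra! hcon
  -- Horizontal and vertical corridors alternate as on a chessboard, so neighbouring corridors are
  -- perpendicular. The lattice step `W / 4` is the offset allowed by `corridor_crossings_meet`.
  let dir : ℤ → ℤ → ℂ := fun i j => if Even (i + j) then 1 else Complex.I
  let ctr : ℤ → ℤ → ℂ := fun i j => ⟨x.re + W / 4 * i, x.im + W / 4 * j⟩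
  have hdir : ∀ i j, dir i j = 1 ∨ dir i j = Complex.I := fun i j => by
    simp only [dir]; split_ifs <;> simp
  have hex : ∀ i j : ℤ, ∃ S : Set ℂ, i ∈ Icc (-16) 16 → j ∈ Icc (-16) 16 →
      S ⊆ D ∧ ∃ (a b : ℂ) (γ : Path a b), a ∈ corridorStart (dir i j) (ctr i j) W ∧
        b ∈ corridorEnd (dir i j) (ctr i j) W ∧ range γ ⊆ corridor (dir i j) (ctr i j) W ∧
        S = range γ := by
    intro i j
    by_cases hij : i ∈ Icc (-16) 16 ∧ j ∈ Icc (-16) 16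
    · obtain ⟨hi, hj⟩ := hij
      have hi1 : (-16 : ℝ) ≤ i := by exact_mod_cast hi.1
      have hi2 : (i : ℝ) ≤ 16 := by exact_mod_cast hi.2
      have hj1 : (-16 : ℝ) ≤ j := by exact_mod_cast hj.1
      have hj2 : (j : ℝ) ≤ 16 := by exact_mod_cast hj.2
      obtain ⟨a, b, γ, h1, h2, h3, h4⟩ := hcon (dir i j) (ctr i j) (hdir i j) (by
        refine (Complex.norm_le_abs_re_add_abs_im _).trans ?_
        have h1 : |(ctr i j - x).re| ≤ 4 * W := by
          simp only [ctr, Complex.sub_re, add_sub_cancel_left, abs_le]; constructor <;> nlinarith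
        have h2 : |(ctr i j - x).im| ≤ 4 * W := by
          simp only [ctr, Complex.sub_im, add_sub_cancel_left, abs_le]; constructor <;> nlinarith
        linarith)
      exact ⟨range γ, fun _ _ => ⟨h4, a, b, γ, h1, h2, h3, rfl⟩⟩
    · exact ⟨∅, fun hi hj => absurd ⟨hi, hj⟩ hij⟩
  choose S hS using hex
  refine false_of_square_of_sets hDo hDs hx hW (S := S) (fun i j hi hj => (hS i j hi hj).1)
    ?_ ?_ ?_ ?_
  · intro i j hi hj
    obtain ⟨-, a, b, γ, -, -, -, h⟩ := hS i j hi hj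
    rw [h]; exact isPreconnected_range γ.continuous
  · intro i j hi hj
    obtain ⟨-, a, b, γ, -, -, -, h⟩ := hS i j hi hj
    rw [h]; exact range_nonempty _
  · intro i j i' j' hi hj hi' hj' h
    wlog hev : Even (i + j) generalizing i j i' j'
    · rw [inter_comm]
      refine this i' j' i j hi' hj' hi hj (by rwa [abs_sub_comm i' i, abs_sub_comm j' j]) ?_
      rw [Int.even_iff] at hev ⊢
      rcases abs_cases (i - i') with h1 | h1 <;> rcases abs_cases (j - j') with h2 | h2 <;> omega
    have hev' : ¬ Even (i' + j') := by
      rw [Int.even_iff] at hev ⊢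
      rcases abs_cases (i - i') with h1 | h1 <;> rcases abs_cases (j - j') with h2 | h2 <;> omega
    obtain ⟨-, a, b, γ, ha, hb, hγ, hh⟩ := hS i j hi hj
    obtain ⟨-, a', b', γ', ha', hb', hγ', hh'⟩ := hS i' j' hi' hj'
    simp only [dir, if_pos hev] at ha hb hγ
    simp only [dir, if_neg hev'] at ha' hb' hγ'
    rw [hh, hh']
    have hi1 : |(i : ℝ) - i'| ≤ 1 := by
      have : |i - i'| ≤ 1 := by linarith [abs_nonneg (j - j')]
      exact_mod_cast this
    have hj1 : |(j : ℝ) - j'| ≤ 1 := by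
      have : |j - j'| ≤ 1 := by linarith [abs_nonneg (i - i')]
      exact_mod_cast this
    rw [abs_le] at hi1 hj1
    refine corridor_crossings_meet ?_ ?_ γ γ' ha hb hγ ha' hb' hγ'
    · simp only [ctr, abs_le]; constructor <;> nlinarith
    · simp only [ctr, abs_le]; constructor <;> nlinarith
  · intro i j hi hj z hz
    obtain ⟨-, a, b, γ, -, -, hγ, hh⟩ := hS i j hi hj
    have := hγ (hh ▸ hz)
    rcases hdir i j with h | h
    · rw [h] at this
      have := mem_corridor_one.1 this
      exact ⟨this.1, this.2.trans (by linarith)⟩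
    · rw [h] at this
      have := mem_corridor_I.1 this
      exact ⟨this.2.trans (by linarith), this.1⟩

/-! ## Sums over lists -/

theorem tsum_list {α : Type*} (f : List α → ℝ≥0∞) :
    ∑' l, f l = f [] + ∑' (y : α) (l : List α), f (y :: l) := by
  classical
  rw [ENNReal.tsum_eq_add_tsum_ite []]
  congr 1
  have hinj : Function.Injective fun p : α × List α => p.1 :: p.2 := by
    rintro ⟨a, l⟩ ⟨b, m⟩ h
    simpa using h
  rw [← ENNReal.tsum_prod, ← hinj.tsum_eq]
  · simp
  · rintro (_ | ⟨y, l⟩) h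
    · simp at h
    · exact ⟨(y, l), rfl⟩

/-- The weight of a list for an automaton with state space `X` reading letters in `Y`: the product
of the transition weights `c`, times the terminal weight `t` of the last state. -/
def listWeight {X Y : Type*} (t : X → ℝ≥0∞) (c : X → Y → ℝ≥0∞) (nx : X → Y → X) :
    X → List Y → ℝ≥0∞
  | x, [] => t x
  | x, y :: l => c x y * listWeight t c nx (nx x y) l

/-- The sum of the weights of all lists. -/
def listSum {X Y : Type*} (t : X → ℝ≥0∞) (c : X → Y → ℝ≥0∞) (nx : X → Y → X) (x : X) : ℝ≥0∞ :=
  ∑' l, listWeight t c nx x l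

theorem listSum_eq {X Y : Type*} (t : X → ℝ≥0∞) (c : X → Y → ℝ≥0∞) (nx : X → Y → X) (x : X) :
    listSum t c nx x = t x + ∑' y, c x y * listSum t c nx (nx x y) := by
  simp only [listSum]
  rw [tsum_list]
  simp only [listWeight, ENNReal.tsum_mul_left]

/-- `listSum` is the least solution of its one-step equation, so every supersolution dominates it.
The induction is on the length at which the sum is truncated. This is how all probabilities and
expectations below are bounded from above. -/
theorem listSum_le {X Y : Type*} {t : X → ℝ≥0∞} {c : X → Y → ℝ≥0∞} {nx : X → Y → X}
    {f : X → ℝ≥0∞} (hf : ∀ x, t x + ∑' y, c x y * f (nx x y) ≤ f x) (x : X) :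
    listSum t c nx x ≤ f x := by
  have key : ∀ n x, ∑' l : List Y, (if l.length < n then listWeight t c nx x l else 0) ≤ f x := by
    intro n
    induction n with
    | zero => simp
    | succ n ih =>
      intro x
      rw [tsum_list]
      refine le_trans (add_le_add (by simp [listWeight]) ?_) (hf x)
      refine ENNReal.tsum_le_tsum fun y => ?_
      refine le_trans (le_of_eq ?_) (mul_le_mul_right (ih (nx x y)) (c x y))
      rw [← ENNReal.tsum_mul_left]
      simp [listWeight]
  rw [listSum, ENNReal.tsum_eq_iSup_sum]
  refine iSup_le fun s => ?_
  refine le_trans ?_ (key (s.sup List.length + 1) x)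
  refine le_trans (le_of_eq ?_) (ENNReal.sum_le_tsum s)
  refine Finset.sum_congr rfl fun l hl => ?_
  rw [if_pos (Nat.lt_succ_of_le (Finset.le_sup (f := List.length) hl))]

/-! ## Hitting probabilities -/

namespace PlanarGraph

variable (G : PlanarGraph)

/-- Only an inequality holds in general: where no edge starts, the convention `0 / 0 = 0` gives the
sum `0`. -/
theorem tsum_q_le (u : ℂ) : ∑' v, G.q u v ≤ 1 := by
  simp only [q, div_eq_mul_inv]
  rw [ENNReal.tsum_mul_right]
  exact ENNReal.mul_inv_le_one _

theorem tsum_q_mul_le (u : ℂ) (b : ℝ≥0∞) : ∑' v, G.q u v * b ≤ b := by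
  rw [ENNReal.tsum_mul_right]
  exact mul_le_of_le_one_left' (G.tsum_q_le u)

variable {G}

theorem weight_ne_zero_of_q {u v : ℂ} (h : G.q u v ≠ 0) : G.weight u v ≠ 0 := fun h' => by
  simp [q, h'] at h

theorem mem_verts_left {u v : ℂ} (h : G.q u v ≠ 0) : u ∈ G.verts :=
  (G.mem_of_edge u v (weight_ne_zero_of_q h)).1

theorem mem_verts_right {u v : ℂ} (h : G.q u v ≠ 0) : v ∈ G.verts :=
  (G.mem_of_edge u v (weight_ne_zero_of_q h)).2

variable (G)

/-- The walk from `u` through the points of the list to `w` uses an edge in `E`. -/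
def Uses (E : ℂ → ℂ → Prop) (w : ℂ) : ℂ → List ℂ → Prop
  | u, [] => E u w
  | u, v :: l => E u v ∨ Uses E w v l

variable {G}

theorem range_walkPath_cons (w u v : ℂ) (l : List ℂ) :
    range (G.walkPath w u (v :: l)) = range (G.arc u v) ∪ range (G.walkPath w v l) := by
  rw [walkPath, Path.trans_range]

theorem source_mem_range_walkPath (w u : ℂ) (l : List ℂ) : u ∈ range (G.walkPath w u l) :=
  ⟨0, Path.source _⟩

/-- Used by contradiction, with `Z` the complement of a separating curve or the domain: a crossing
that has to leave `Z` must use an edge in `E`. -/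
theorem range_walkPath_subset {E : ℂ → ℂ → Prop} {R Z : Set ℂ}
    (hE : ∀ a b, G.q a b ≠ 0 → range (G.arc a b) ⊆ R → ¬ E a b → range (G.arc a b) ⊆ Z)
    {w : ℂ} {l : List ℂ} {u : ℂ} (hR : range (G.walkPath w u l) ⊆ R)
    (hw : G.walkProb w u l ≠ 0) (hU : ¬ Uses E w u l) : range (G.walkPath w u l) ⊆ Z := by
  induction l generalizing u with
  | nil => exact hE _ _ hw hR hU
  | cons v l ih =>
    rw [range_walkPath_cons, union_subset_iff] at hR ⊢
    simp only [walkProb, ne_eq, mul_eq_zero, not_or] at hw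
    simp only [Uses, not_or] at hU
    exact ⟨hE _ _ hw.1 hR.1 hU.1, ih hR.2 hw.2 hU.2⟩

-- Optional stopping: `f` is a supermartingale up to the first use of an edge in `E`, where it is
-- replaced by the value `β`, and every successful crossing uses such an edge. The event is encoded
-- by an automaton whose flag records whether `E` has been used.
open Classical in
theorem mul_hitProb_le_of_uses {f : ℂ → ℝ≥0∞} {β : ℝ≥0∞} {E : ℂ → ℂ → Prop} {T R : Set ℂ}
    (hf : ∀ v ∈ G.verts ∩ R, ∑' y, G.q v y * (if E v y then β else f y) ≤ f v) {v : ℂ}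
    (hv : v ∈ G.verts) (hvR : v ∈ R)
    (hU : ∀ l, ∀ w ∈ T, range (G.walkPath w v l) ⊆ R → G.walkProb w v l ≠ 0 → Uses E w v l) :
    β * G.hitProb v T R ≤ f v := by
  let C : ℂ → ℂ → Prop := fun v y => y ∉ T ∧ range (G.arc v y) ⊆ R
  let t : Prop × ℂ → ℝ≥0∞ := fun x =>
    ∑' w, if (w ∈ T ∧ range (G.arc x.2 w) ⊆ R) ∧ (x.1 ∨ E x.2 w) then β * G.q x.2 w else 0
  let c : Prop × ℂ → ℂ → ℝ≥0∞ := fun x y => if C x.2 y then G.q x.2 y else 0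
  let nx : Prop × ℂ → ℂ → Prop × ℂ := fun x y => (x.1 ∨ E x.2 y, y)
  let H : ℂ → List ℂ → ℂ → Prop := fun v l w =>
    (∀ y ∈ l, y ∉ T) ∧ w ∈ T ∧ range (G.walkPath w v l) ⊆ R
  have hlw : ∀ (l : List ℂ) (b : Prop) (v : ℂ), listWeight t c nx (b, v) l =
      ∑' w, if H v l w ∧ (b ∨ Uses E w v l) then β * G.walkProb w v l else 0 := by
    intro l
    induction l with
    | nil =>
      intro b v
      simp [listWeight, t, H, Uses, walkPath, walkProb]
    | cons y l ih =>
      intro b v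
      simp only [listWeight, ih, nx]
      rw [← ENNReal.tsum_mul_left]
      refine tsum_congr fun w => ?_
      simp only [c, C, H, range_walkPath_cons, union_subset_iff, Uses, walkProb, List.mem_cons,
        forall_eq_or_imp]
      by_cases h1 : y ∉ T ∧ range (G.arc v y) ⊆ R
      · rw [if_pos h1, mul_ite, mul_zero]
        by_cases h2 : H y l w ∧ ((b ∨ E v y) ∨ Uses E w y l)
        · rw [if_pos h2, if_pos ⟨⟨⟨h1.1, h2.1.1⟩, h2.1.2.1, h1.2, h2.1.2.2⟩, or_assoc.1 h2.2⟩]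
          ring
        · rw [if_neg h2, if_neg]
          exact fun h => h2 ⟨⟨h.1.1.2, h.1.2.1, h.1.2.2.2⟩, or_assoc.2 h.2⟩
      · rw [if_neg h1, zero_mul, if_neg]
        tauto
  -- The supersolution is `β` once the flag is set and `f` before. The value `⊤` makes the
  -- inequality void at points outside `R` or not vertices, which walks from `v` inside `R` never
  -- reach.
  have hbound : ∀ x, listSum t c nx x ≤
      if x.1 then β else if x.2 ∈ G.verts ∩ R then f x.2 else ⊤ := by
    refine listSum_le ?_
    rintro ⟨b, v⟩
    by_cases hb : b
    · simp only [t, c, nx, hb, true_or, and_true, if_true]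
      rw [← ENNReal.tsum_add]
      refine le_trans (ENNReal.tsum_le_tsum fun w => ?_) (G.tsum_q_mul_le v β)
      by_cases hw : w ∈ T
      · simp only [hw, C, not_true, false_and, if_false, zero_mul, add_zero, true_and]
        split_ifs
        · rw [mul_comm]
        · exact zero_le
      · simp only [hw, C, false_and, if_false, zero_add]
        split_ifs
        · exact le_rfl
        · simp
    · by_cases hvR : v ∈ G.verts ∩ R
      · simp only [t, c, nx, hb, false_or, if_false, hvR, if_true]
        refine le_trans ?_ (hf v hvR)
        rw [← ENNReal.tsum_add]
        refine ENNReal.tsum_le_tsum fun w => ?_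
        by_cases hq : G.q v w = 0
        · simp [hq]
        by_cases hR : range (G.arc v w) ⊆ R
        · have hwR : w ∈ G.verts ∩ R := ⟨mem_verts_right hq, hR ⟨1, Path.target _⟩⟩
          by_cases hw : w ∈ T <;> by_cases hE : E v w <;> simp [hw, C, hR, hE, hwR, mul_comm]
        · simp [C, hR]
      · simp [hb, hvR]
  have hhit : β * G.hitProb v T R = listSum t c nx (False, v) := by
    rw [hitProb, listSum, ← ENNReal.tsum_mul_left]
    change ∑' i : {x : List ℂ × ℂ | H v x.1 x.2}, β * G.walkProb i.1.2 v i.1.1 = _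
    rw [tsum_subtype {x : List ℂ × ℂ | H v x.1 x.2} fun x => β * G.walkProb x.2 v x.1]
    rw [ENNReal.tsum_prod']
    refine tsum_congr fun l => ?_
    rw [hlw]
    refine tsum_congr fun w => ?_
    by_cases h0 : G.walkProb w v l = 0
    · simp [h0, indicator]
    · simp only [indicator, mem_ofPred_eq, false_or]
      refine if_congr ⟨fun h => ⟨h, hU l w h.2.1 h.2.2 h0⟩, fun h => h.1⟩ rfl rfl
  rw [hhit]
  refine (hbound _).trans ?_
  simp [hv, hvR]

/-! ### Superharmonic functions under the crossing estimate -/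

/-- Superharmonicity, at the vertices in `S`, for the random walk. -/
def SuperharmonicOn (G : PlanarGraph) (f : ℂ → ℝ≥0∞) (S : Set ℂ) : Prop :=
  ∀ v ∈ G.verts ∩ S, ∑' y, G.q v y * f y ≤ f v

theorem SuperharmonicOn.mono {f : ℂ → ℝ≥0∞} {S S' : Set ℂ} (h : G.SuperharmonicOn f S)
    (hS : S' ⊆ S) : G.SuperharmonicOn f S' := fun v hv => h v ⟨hv.1, hS hv.2⟩

/-- The crossing estimate, in a form symmetric in the four directions: at all scales from `s₀` on,
the corridors are crossed with probability at least `a`. -/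
structure CrossingEstimate (G : PlanarGraph) (s₀ : ℝ) (a : ℝ≥0∞) : Prop where
  pos : 0 < s₀
  ne_zero : a ≠ 0
  le_one : a ≤ 1
  cross : ∀ e : ℂ, e = 1 ∨ e = -1 ∨ e = Complex.I ∨ e = -Complex.I → ∀ (m : ℂ) (s : ℝ), s₀ ≤ s →
    ∀ v ∈ G.verts, v ∈ corridorStart e m s → a ≤ G.hitProb v (corridorEnd e m s) (corridor e m s)

theorem norm_eq_one_of_dir {e : ℂ} (he : e = 1 ∨ e = -1 ∨ e = Complex.I ∨ e = -Complex.I) :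
    ‖e‖ = 1 := by
  rcases he with rfl | rfl | rfl | rfl <;> simp

theorem corridorStart_subset {e m : ℂ} {s : ℝ} (he : e = 1 ∨ e = -1 ∨ e = Complex.I ∨ e = -Complex.I)
    (hs : 0 < s) : corridorStart e m s ⊆ corridor e m s := by
  intro x hx
  have h1 := abs_lt.1 (re_lt_of_mem_ball hx)
  have h2 := abs_lt.1 (im_lt_of_mem_ball hx)
  rcases he with rfl | rfl | rfl | rfl <;> simp at h1 h2 <;>
    constructor <;> simp [abs_le] <;> constructor <;> linarith

namespace CrossingEstimate

variable {s₀ : ℝ} {a : ℝ≥0∞}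

theorem le_of_uses (hG : G.CrossingEstimate s₀ a) {e m : ℂ} {s : ℝ}
    (he : e = 1 ∨ e = -1 ∨ e = Complex.I ∨ e = -Complex.I) (hs : s₀ ≤ s)
    {f : ℂ → ℝ≥0∞} {β : ℝ≥0∞} {E : ℂ → ℂ → Prop} [∀ v y, Decidable (E v y)]
    (hf : ∀ v ∈ G.verts ∩ corridor e m s, ∑' y, G.q v y * (if E v y then β else f y) ≤ f v) {v : ℂ}
    (hv : v ∈ G.verts) (hvS : v ∈ corridorStart e m s)
    (hU : ∀ l, ∀ w ∈ corridorEnd e m s, range (G.walkPath w v l) ⊆ corridor e m s →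
      G.walkProb w v l ≠ 0 → Uses E w v l) : a * β ≤ f v := by
  have hvR : v ∈ corridor e m s := corridorStart_subset he (hG.pos.trans_le hs) hvS
  refine le_trans ?_ (mul_hitProb_le_of_uses (E := E) (β := β) ?_ hv hvR hU)
  · rw [mul_comm]
    exact mul_le_mul_right (hG.cross e he m s hs v hv hvS) β
  · intro v hv
    convert hf v hv

/-- One corridor joins the two balls, and the stopping edges are those that enter the target ball.
-/
theorem le_of_neighbour_ball (hG : G.CrossingEstimate s₀ a) {e c : ℂ} {s : ℝ}
    (he : e = 1 ∨ e = -1 ∨ e = Complex.I ∨ e = -Complex.I) (hs : s₀ ≤ s)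
    {f : ℂ → ℝ≥0∞} {β : ℝ≥0∞} (hf : G.SuperharmonicOn f (Metric.closedBall c (3 * s)))
    (hβ : ∀ v ∈ G.verts ∩ Metric.ball (c + 2 * s * e) (s / 4), β ≤ f v) {v : ℂ}
    (hv : v ∈ G.verts ∩ Metric.ball c (s / 4)) : a * β ≤ f v := by
  classical
  have hs0 : 0 < s := hG.pos.trans_le hs
  have h1 : corridorStart e (c + s * e) s = Metric.ball c (s / 4) := by
    simp [corridorStart]
  have h2 : corridorEnd e (c + s * e) s = Metric.ball (c + 2 * s * e) (s / 4) := by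
    simp only [corridorEnd]; congr 1; ring
  refine hG.le_of_uses (E := fun _ y => y ∈ Metric.ball (c + 2 * s * e) (s / 4)) he hs
    (m := c + s * e) ?_ hv.1 (h1 ▸ hv.2) ?_
  · intro v hv
    refine le_trans (ENNReal.tsum_le_tsum fun y => ?_) (hf v ⟨hv.1, ?_⟩)
    · by_cases hq : G.q v y = 0
      · simp [hq]
      · split_ifs with hy
        · gcongr
          exact hβ y ⟨mem_verts_right hq, hy⟩
        · exact le_rfl
    · have h3 := dist_le_of_mem_corridor (norm_eq_one_of_dir he) hv.2
      rw [mem_closedBall_iff_norm]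
      calc ‖v - c‖ = ‖(v - (c + s * e)) + s * e‖ := by congr 1; ring
        _ ≤ ‖v - (c + s * e)‖ + ‖s * e‖ := norm_add_le _ _
        _ ≤ 2 * s + s := by
          gcongr
          simp [norm_eq_one_of_dir he, abs_of_pos hs0]
        _ = 3 * s := by ring
  · rintro l w hw - -
    rw [h2] at hw
    clear hv
    induction l generalizing v with
    | nil => exact hw
    | cons y l ih => exact Or.inr ih

/-- Balls at the points of a lattice of mesh `2 * s` are joined by a chain of `k` corridors, each
costing a factor `a`. -/
theorem le_of_lattice_ball (hG : G.CrossingEstimate s₀ a) {s : ℝ} (hs : s₀ ≤ s)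
    {f : ℂ → ℝ≥0∞} {β : ℝ≥0∞} (k : ℕ) {i j : ℤ} (hk : i.natAbs + j.natAbs = k) {c : ℂ}
    (hf : G.SuperharmonicOn f (Metric.closedBall c (s * (2 * k + 3))))
    (hβ : ∀ v ∈ G.verts ∩ Metric.ball (c + 2 * s * (i + j * Complex.I)) (s / 4), β ≤ f v) {v : ℂ}
    (hv : v ∈ G.verts ∩ Metric.ball c (s / 4)) : a ^ k * β ≤ f v := by
  have hs0 : 0 < s := hG.pos.trans_le hs
  induction k generalizing i j c v with
  | zero =>
    have hi : i = 0 := by omega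
    have hj : j = 0 := by omega
    subst hi hj
    simpa using hβ v (by simpa using hv)
  | succ k ih =>
    obtain ⟨e, i', j', he, hk', hij⟩ : ∃ (e : ℂ) (i' j' : ℤ),
        (e = 1 ∨ e = -1 ∨ e = Complex.I ∨ e = -Complex.I) ∧ i'.natAbs + j'.natAbs = k ∧
        (i + j * Complex.I : ℂ) = e + (i' + j' * Complex.I) := by
      rcases lt_trichotomy i 0 with hi | hi | hi
      · exact ⟨-1, i + 1, j, by simp, by omega, by push_cast; ring⟩
      · rcases lt_or_ge j 0 with hj | hj
        · exact ⟨-Complex.I, i, j + 1, by simp, by omega, by push_cast; ring⟩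
        · exact ⟨Complex.I, i, j - 1, by simp, by omega, by push_cast; ring⟩
      · exact ⟨1, i - 1, j, by simp, by omega, by push_cast; ring⟩
    rw [pow_succ', mul_assoc]
    refine hG.le_of_neighbour_ball he hs (c := c)
      (hf.mono (Metric.closedBall_subset_closedBall ?_)) ?_ hv
    · push_cast
      nlinarith [(Nat.cast_nonneg k : (0 : ℝ) ≤ k)]
    · intro y hy
      refine ih hk' (hf.mono (Metric.closedBall_subset_closedBall' ?_)) ?_ hy
      · have : dist (c + 2 * s * e) c = 2 * s := by
          simp [dist_eq_norm, norm_eq_one_of_dir he, abs_of_pos hs0]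
        rw [this]
        push_cast
        linarith
      · intro z hz
        refine hβ z ⟨hz.1, ?_⟩
        rw [hij]
        convert hz.2 using 2
        ring

/-- A superharmonic function which is bounded below on the vertices in some ball is bounded below
at the vertices at comparable distance. -/
theorem le_of_ball (hG : G.CrossingEstimate s₀ a) {t : ℝ} (ht : 2 * s₀ ≤ t) (K : ℕ)
    {v p : ℂ} (hv : v ∈ G.verts) (hp : ‖p - v‖ ≤ K * t) {f : ℂ → ℝ≥0∞} {β : ℝ≥0∞}
    (hf : G.SuperharmonicOn f (Metric.closedBall v ((2 * K + 3) * t)))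
    (hβ : ∀ y ∈ G.verts ∩ Metric.ball p t, β ≤ f y) : a ^ (2 * K + 1) * β ≤ f v := by
  have ht0 : 0 < t := by linarith [hG.pos]
  let i : ℤ := round ((p - v).re / t)
  let j : ℤ := round ((p - v).im / t)
  have hi := abs_le.1 (abs_sub_round ((p - v).re / t))
  have hj := abs_le.1 (abs_sub_round ((p - v).im / t))
  have hre : |(p - v).re / t| ≤ K := by
    rw [abs_div, abs_of_pos ht0, div_le_iff₀ ht0]
    exact (Complex.abs_re_le_norm _).trans hp
  have him : |(p - v).im / t| ≤ K := by
    rw [abs_div, abs_of_pos ht0, div_le_iff₀ ht0]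
    exact (Complex.abs_im_le_norm _).trans hp
  rw [abs_le] at hre him
  have hi' : i.natAbs ≤ K := by
    have h1 : (i : ℝ) < K + 1 := by simp only [i]; linarith
    have h2 : -(K + 1 : ℝ) < i := by simp only [i]; linarith
    have h1' : i < K + 1 := by exact_mod_cast h1
    have h2' : -(K + 1 : ℤ) < i := by exact_mod_cast h2
    omega
  have hj' : j.natAbs ≤ K := by
    have h1 : (j : ℝ) < K + 1 := by simp only [j]; linarith
    have h2 : -(K + 1 : ℝ) < j := by simp only [j]; linarith
    have h1' : j < K + 1 := by exact_mod_cast h1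
    have h2' : -(K + 1 : ℤ) < j := by exact_mod_cast h2
    omega
  have hkK : i.natAbs + j.natAbs ≤ 2 * K := by omega
  have hkK' : ((i.natAbs + j.natAbs : ℕ) : ℝ) ≤ 2 * K := by exact_mod_cast hkK
  -- The lattice has mesh `t`. Rounding moves `p` by at most `t / √2 ≤ 3 / 4 * t`, and the small
  -- balls have radius `t / 8`, so the last one lies in the ball around `p`.
  refine le_trans ?_ (hG.le_of_lattice_ball (s := t / 2) (by linarith) _ (i := i) (j := j) rfl
    (c := v) (β := β)
    (hf.mono (Metric.closedBall_subset_closedBall ?_)) ?_ ⟨hv, Metric.mem_ball_self (by linarith)⟩)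
  · gcongr 1
    exact pow_le_pow_right_of_le_one' hG.le_one (by omega)
  · nlinarith
  · intro y hy
    refine hβ y ⟨hy.1, ?_⟩
    have h1 := mem_ball_iff_norm.1 hy.2
    rw [mem_ball_iff_norm]
    have h2 : ‖v + 2 * ((t / 2 : ℝ) : ℂ) * (i + j * Complex.I) - p‖ ≤ 3 / 4 * t := by
      rw [← sq_le_sq₀ (norm_nonneg _) (by positivity), Complex.sq_norm, Complex.normSq_apply]
      have e1 : (v + 2 * ((t / 2 : ℝ) : ℂ) * (i + j * Complex.I) - p).re = t * (i - (p - v).re / t) := by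
        field_simp
        simp
        ring
      have e2 : (v + 2 * ((t / 2 : ℝ) : ℂ) * (i + j * Complex.I) - p).im = t * (j - (p - v).im / t) := by
        field_simp
        simp
        ring
      rw [e1, e2]
      have f1 : (i - (p - v).re / t) ^ 2 ≤ 1 / 4 := by simp only [i]; nlinarith
      have f2 : (j - (p - v).im / t) ^ 2 ≤ 1 / 4 := by simp only [j]; nlinarith
      nlinarith [sq_nonneg t]
    calc ‖y - p‖ = ‖(y - (v + 2 * ((t / 2 : ℝ) : ℂ) * (i + j * Complex.I))) +
          (v + 2 * ((t / 2 : ℝ) : ℂ) * (i + j * Complex.I) - p)‖ := by congr 1; ring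
      _ ≤ _ := norm_add_le _ _
      _ < t := by linarith

/-- In a ball without vertices the constant function `1` is vacuously at least `β = ⊤`, and
transporting this bound to an existing vertex gives `⊤ ≤ 1`. -/
theorem exists_vert_mem_ball (hG : G.CrossingEstimate s₀ a) {t : ℝ} (ht : 2 * s₀ ≤ t) (p : ℂ) :
    (G.verts ∩ Metric.ball p t).Nonempty := by
  by_contra h
  rw [not_nonempty_iff_eq_empty] at h
  obtain ⟨v, hv⟩ := G.infinite.nonempty
  have ht0 : 0 < t := by linarith [hG.pos]
  obtain ⟨K, hK⟩ := exists_nat_ge (‖p - v‖ / t)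
  have := hG.le_of_ball ht K hv ((div_le_iff₀ ht0).1 hK) (f := fun _ => 1) (β := ⊤)
    (fun v _ => by simpa using G.tsum_q_le v) (by simp [h])
  rw [ENNReal.mul_top (pow_ne_zero _ hG.ne_zero)] at this
  simp at this

end CrossingEstimate

end PlanarGraph

/-! ### Short edges, the Harnack inequality and decay near the complement of the domain -/

namespace PlanarGraph

variable {G : PlanarGraph} {s₀ : ℝ} {a : ℝ≥0∞}

theorem exists_common_vertex {x y u v z : ℂ} (h₁ : G.weight x y ≠ 0) (h₂ : G.weight u v ≠ 0)
    (hz : z ∈ range (G.arc x y)) (hz' : z ∈ range (G.arc u v)) :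
    (x = u ∨ x = v) ∨ (y = u ∨ y = v) := by
  by_cases h : s(x, y) = s(u, v)
  · rw [Sym2.eq_iff] at h
    tauto
  · have := G.arc_inter x y u v h₁ h₂ h ⟨hz, hz'⟩
    simp only [mem_inter_iff, mem_insert_iff, mem_singleton_iff] at this
    obtain ⟨rfl | rfl, h | h⟩ := this <;> tauto

namespace CrossingEstimate

theorem norm_corridorStart_sub_le {e m : ℂ} {s : ℝ} (he : ‖e‖ = 1) (hs : 0 < s) :
    ‖m - s * e - m‖ ≤ s := by
  simp [he, abs_of_pos hs]

theorem dir_of_or {e : ℂ} (he : e = 1 ∨ e = Complex.I) :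
    e = 1 ∨ e = -1 ∨ e = Complex.I ∨ e = -Complex.I := by tauto

/-- Under the crossing estimate, the edges are short. -/
theorem arc_subset (hG : G.CrossingEstimate s₀ a) {u v : ℂ} (huv : G.weight u v ≠ 0) :
    range (G.arc u v) ⊆ Metric.closedBall u (640 * s₀) := by
  have hs₀ := hG.pos
  by_contra hcon
  rw [not_subset] at hcon
  obtain ⟨_, ⟨t₂, rfl⟩, ht₂⟩ := hcon
  rw [mem_closedBall_iff_norm, not_le] at ht₂
  have hf : Continuous fun t : I => ‖G.arc u v t - u‖ := by fun_prop
  obtain ⟨t₁, -, ht₁⟩ := intermediate_value_Icc (unitInterval.nonneg' (t := t₂)) hf.continuousOn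
      (show 160 * s₀ ∈ Icc _ _ from ⟨by simp [hs₀.le], by linarith⟩)
  -- A long edge has a point far from both endpoints. The arc from this point to `v` blocks a
  -- corridor of size at most `32 * s₀` within distance `96 * s₀`, hence away from `u` and `v`. By
  -- planarity no walk in the corridor can meet the arc, so the corridor could not be crossed.
  obtain ⟨t, h1, h2⟩ : ∃ t, 160 * s₀ ≤ ‖G.arc u v t - u‖ ∧ 160 * s₀ ≤ ‖G.arc u v t - v‖ := by
    by_contra! h
    have h1 := h t₁ ht₁.ge
    have h2 := h t₂ (by linarith)
    have h3 := norm_sub_le_norm_sub_add_norm_sub (G.arc u v t₂) v (G.arc u v t₁)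
    have h4 := norm_sub_le_norm_sub_add_norm_sub (G.arc u v t₂) (G.arc u v t₁) u
    rw [norm_sub_rev v] at h3
    simp only at ht₁
    linarith
  let c := (G.arc u v).subpath t 1
  have hc : range c ⊆ range (G.arc u v) := by
    rw [Path.range_subpath]; exact image_subset_range _ _
  obtain ⟨e, m, s, he, hs1, hs2, hm, hmeet⟩ := exists_corridor_of_path c (r := 16 * s₀)
    (by linarith) (by rw [norm_sub_rev, Path.target]; linarith)
  have hs : 0 < s := by linarith
  have he' := dir_of_or he
  obtain ⟨x, hx, hxb⟩ := hG.exists_vert_mem_ball (t := s / 4) (by linarith) (m - s * e)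
  have hR : ∀ y ∈ corridor e m s, y ≠ u ∧ y ≠ v := by
    intro y hy
    have h3 := dist_le_of_mem_corridor (norm_eq_one_of_dir he') hy
    have h4 := norm_sub_le_norm_sub_add_norm_sub y m (G.arc u v t)
    constructor
    · rintro rfl
      rw [norm_sub_rev] at h1
      linarith
    · rintro rfl
      rw [norm_sub_rev] at h2
      linarith
  -- With no stopping edges and `f = 0`, `β = 1`, the conclusion reads `a ≤ 0`.
  have := hG.le_of_uses (E := fun _ _ => False) (f := fun _ => 0) (β := 1) he' (m := m) (s := s)
    (by linarith) (by simp) hx hxb (by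
      intro l w hw hwR hw0
      by_contra hU
      obtain ⟨z, hz, hz'⟩ := hmeet (G.walkPath w x l) hxb hw hwR
      refine range_walkPath_subset (Z := (range (G.arc u v))ᶜ) ?_ hwR hw0 hU hz (hc hz')
      intro y y' hq hyR _ z hz hz'
      have h5 := hR _ (hyR ⟨0, Path.source _⟩)
      have h6 := hR _ (hyR ⟨1, Path.target _⟩)
      have := exists_common_vertex (weight_ne_zero_of_q hq) huv hz hz'
      tauto)
  simp [hG.ne_zero] at this

/-- If no edge left `S`, the indicator of the complement of `S` would be superharmonic. It vanishes
at `u` and equals `1` on a ball far away, against `le_of_ball`. This is what makes the maximum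
principle available. -/
theorem not_closed_of_bounded (hG : G.CrossingEstimate s₀ a) {S : Set ℂ}
    (hb : Bornology.IsBounded S) {u : ℂ} (hu : u ∈ G.verts ∩ S) :
    ∃ v ∈ S, ∃ w ∉ S, G.q v w ≠ 0 := by
  classical
  by_contra! hcl
  have hs₀ := hG.pos
  obtain ⟨B, hB⟩ := hb.subset_closedBall 0
  have hB0 : 0 ≤ B := by
    have := hB hu.2
    rw [mem_closedBall_zero_iff] at this
    exact (norm_nonneg _).trans this
  let f : ℂ → ℝ≥0∞ := fun v => if v ∈ S then 0 else 1
  let p : ℂ := ((B + 2 * s₀ : ℝ) : ℂ)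
  obtain ⟨K, hK⟩ := exists_nat_ge (‖p - u‖ / (2 * s₀))
  have := hG.le_of_ball le_rfl K hu.1 ((div_le_iff₀ (by linarith)).1 hK) (f := f) (β := 1) ?_ ?_
  · simp [f, hu.2, hG.ne_zero] at this
  · intro v hv
    by_cases hvS : v ∈ S
    · refine le_of_eq ?_
      simp only [f, hvS, if_true, ENNReal.tsum_eq_zero, mul_eq_zero, ite_eq_left_iff]
      intro y
      by_cases hy : y ∈ S
      · simp [hy]
      · exact Or.inl (hcl v hvS y hy)
    · simp only [f, hvS, if_false]
      refine le_trans (ENNReal.tsum_le_tsum fun y => ?_) (G.tsum_q_mul_le v 1)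
      gcongr
      split_ifs <;> simp
  · intro y hy
    have : y ∉ S := fun h => by
      have h1 := mem_closedBall_zero_iff.1 (hB h)
      have h2 := mem_ball_iff_norm.1 hy.2
      have h3 : ‖p‖ = B + 2 * s₀ := by
        simp only [p, Complex.norm_real, Real.norm_eq_abs]; exact abs_of_nonneg (by linarith)
      have h4 := norm_sub_norm_le p y
      rw [norm_sub_rev] at h2
      linarith
    simp [f, this]

/-- From each vertex, along edges between vertices at which a harmonic function is at least as
large as at the starting vertex, one can leave each bounded set. -/
theorem exists_high_path (hG : G.CrossingEstimate s₀ a) {S : Set ℂ}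
    (hb : Bornology.IsBounded S) {h : ℂ → ℝ≥0∞} (hfin : ∀ v, h v ≠ ∞)
    (harm : ∀ v ∈ G.verts ∩ S, h v = ∑' y, G.q v y * h y) {u : ℂ} (hu : u ∈ G.verts ∩ S) :
    ∃ w ∉ S, ∃ c : Path u w, ∀ x ∈ range c, (x ∈ G.verts ∧ h u ≤ h x) ∨
      ∃ y z, G.q y z ≠ 0 ∧ h u ≤ h y ∧ h u ≤ h z ∧ x ∈ range (G.arc y z) := by
  let Q : Set ℂ := {y | Relation.ReflTransGen (fun y z => G.q y z ≠ 0 ∧ h u ≤ h z) u y}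
  have hQ : ∀ y ∈ Q, y ∈ G.verts ∧ h u ≤ h y := by
    intro y hy
    induction hy with
    | refl => exact ⟨hu.1, le_rfl⟩
    | tail _ h _ => exact ⟨mem_verts_right h.1, h.2⟩
  have hpath : ∀ y ∈ Q, ∃ c : Path u y, ∀ x ∈ range c, (x ∈ G.verts ∧ h u ≤ h x) ∨
      ∃ y z, G.q y z ≠ 0 ∧ h u ≤ h y ∧ h u ≤ h z ∧ x ∈ range (G.arc y z) := by
    intro y hy
    induction hy with
    | refl => exact ⟨Path.refl u, by rintro _ ⟨t, rfl⟩; exact Or.inl ⟨hu.1, le_rfl⟩⟩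
    | @tail y z hy hz ih =>
      obtain ⟨c, hc⟩ := ih
      refine ⟨c.trans (G.arc y z), fun x hx => ?_⟩
      rw [Path.trans_range] at hx
      rcases hx with hx | hx
      · exact hc x hx
      · exact Or.inr ⟨y, z, hz.1, (hQ y hy).2, hz.2, hx⟩
  by_cases hQS : Q ⊆ S
  · exfalso
    -- Maximum principle: if `Q` stayed in `S` it would be finite, so `h` would have a maximum on
    -- it. Some edge leaves the set of maximizers, and at its starting point the average of `h` is
    -- strictly below the maximum.
    have hQfin : Q.Finite := by
      refine (G.finite_verts _ hb.isCompact_closure).subset fun y hy => ?_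
      exact ⟨(hQ y hy).1, subset_closure (hQS hy)⟩
    have huQ : u ∈ Q := Relation.ReflTransGen.refl
    obtain ⟨y₀, hy₀, hmax⟩ := exists_max_image Q h hQfin ⟨u, huQ⟩
    obtain ⟨v, ⟨hv, hvm⟩, w, hw, hq⟩ := hG.not_closed_of_bounded (S := {y ∈ Q | h y = h y₀})
      (hb.subset fun y hy => hQS hy.1) (u := y₀) ⟨(hQ _ hy₀).1, hy₀, rfl⟩
    have hle : ∀ z, G.q v z ≠ 0 → h z ≤ h y₀ := fun z hz => by
      rcases le_total (h u) (h z) with hz' | hz'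
      · exact hmax z (Relation.ReflTransGen.tail hv ⟨hz, hz'⟩)
      · exact hz'.trans (hQ _ hy₀).2
    have hlt : h w < h y₀ := by
      refine lt_of_le_of_ne (hle w hq) fun heq => hw ⟨?_, heq⟩
      exact Relation.ReflTransGen.tail hv ⟨hq, heq ▸ (hQ _ hy₀).2⟩
    have h1 := harm v ⟨(hQ v hv).1, hQS hv⟩
    have hqt : G.q v w ≠ ∞ :=
      ne_top_of_le_ne_top ENNReal.one_ne_top ((ENNReal.le_tsum w).trans (G.tsum_q_le v))
    have h2 : ∑' z, G.q v z * h z < ∑' z, G.q v z * h y₀ := by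
      refine ENNReal.tsum_lt_tsum (i := w) (h1 ▸ hfin v) (fun z => ?_)
        ((ENNReal.mul_lt_mul_iff_right hq hqt).2 hlt)
      by_cases hz : G.q v z = 0
      · simp [hz]
      · gcongr
        exact hle z hz
    exact absurd ((h2.trans_le (G.tsum_q_mul_le v _))) (by rw [← h1, hvm]; exact lt_irrefl _)
  · obtain ⟨w, hw, hwS⟩ := not_subset.1 hQS
    exact ⟨w, hwS, hpath w hw⟩

/-- The elliptic Harnack inequality. -/
theorem harnack (hG : G.CrossingEstimate s₀ a) {x : ℂ} {r : ℝ} (hr : 16 * s₀ ≤ r) {h : ℂ → ℝ≥0∞}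
    (hfin : ∀ v, h v ≠ ∞)
    (harm : ∀ v ∈ G.verts ∩ Metric.closedBall x (12 * r), h v = ∑' y, G.q v y * h y) {u u₀ : ℂ}
    (hu : u ∈ G.verts ∩ Metric.closedBall x (r / 2))
    (hu₀ : u₀ ∈ G.verts ∩ Metric.closedBall x (r / 2)) : a ^ 82 * h u ≤ h u₀ := by
  classical
  have hs₀ := hG.pos
  have hux := mem_closedBall_iff_norm.1 hu.2
  have hux₀ := mem_closedBall_iff_norm.1 hu₀.2
  obtain ⟨w, hw, c, hc⟩ := hG.exists_high_path Metric.isBounded_closedBall hfin harm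
    ⟨hu.1, Metric.closedBall_subset_closedBall (by linarith) hu.2⟩
  have hwu : r ≤ ‖w - u‖ := by
    rw [mem_closedBall_iff_norm, not_le] at hw
    have := norm_sub_le_norm_sub_add_norm_sub w u x
    linarith
  obtain ⟨e, m, s, he, hs1, hs2, hm, hmeet⟩ := exists_corridor_of_path c (by linarith) hwu
  have hs : 0 < s := by linarith
  have he' := dir_of_or he
  -- The path `c` of high values blocks the corridor. A walk crossing it shares a vertex with `c`,
  -- so it uses an edge with an endpoint where `h ≥ h u`.
  have hstart : ∀ v ∈ G.verts ∩ corridorStart e m s, a * h u ≤ h v := by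
    intro v hv
    refine hG.le_of_uses (E := fun y z => h u ≤ h y ∨ h u ≤ h z) he' (by linarith) ?_ hv.1 hv.2 ?_
    · intro v hv
      by_cases huv : h u ≤ h v
      · simp only [huv, true_or, if_true]
        exact (G.tsum_q_mul_le v _).trans huv
      · refine le_trans ?_ (harm v ⟨hv.1, ?_⟩).ge
        · refine ENNReal.tsum_le_tsum fun y => ?_
          gcongr
          split_ifs with h1
          · exact h1.resolve_left huv
          · exact le_rfl
        · have h1 := dist_le_of_mem_corridor (norm_eq_one_of_dir he') hv.2
          have h2 := norm_sub_le_norm_sub_add_norm_sub v m x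
          have h3 := norm_sub_le_norm_sub_add_norm_sub m u x
          rw [mem_closedBall_iff_norm]
          linarith
    · intro l w hw hwR hw0
      by_contra hU
      obtain ⟨z, hz, hz'⟩ := hmeet (G.walkPath w v l) hv.2 hw hwR
      refine range_walkPath_subset (Z := (range c)ᶜ) ?_ hwR hw0 hU hz hz'
      intro y y' hq _ hE z hz hz'
      rcases hc z hz' with ⟨h1, h2⟩ | ⟨b, b', hb, h1, h2, h3⟩
      · rcases G.arc_verts y y' (weight_ne_zero_of_q hq) ⟨hz, h1⟩ with rfl | rfl
        · exact hE (Or.inl h2)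
        · exact hE (Or.inr h2)
      · rcases exists_common_vertex (weight_ne_zero_of_q hq) (weight_ne_zero_of_q hb) hz h3 with
          (rfl | rfl) | rfl | rfl <;> tauto
  -- The start of the corridor is within `5 * r` of `u₀`. In units of `r / 8` this is `40`, so
  -- transporting the bound costs `a ^ 81`, and the crossing itself the last factor of `a ^ 82`.
  have h1 : ‖m - s * e - u₀‖ ≤ ((40 : ℕ) : ℝ) * (r / 8) := by
    have h2 := norm_sub_le_norm_sub_add_norm_sub (m - s * e) m u₀
    have h3 := norm_sub_le_norm_sub_add_norm_sub m u u₀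
    have h4 := norm_sub_le_norm_sub_add_norm_sub u x u₀
    have h5 := norm_corridorStart_sub_le (m := m) (norm_eq_one_of_dir he') hs
    rw [norm_sub_rev x] at h4
    push_cast
    linarith
  have := hG.le_of_ball (t := r / 8) (by linarith) 40 hu₀.1 h1 (f := h) (β := a * h u) ?_ ?_
  · rwa [← mul_assoc, ← pow_succ] at this
  · intro v hv
    refine (harm v ⟨hv.1, ?_⟩).ge
    have h2 := mem_closedBall_iff_norm.1 hv.2
    have h3 := norm_sub_le_norm_sub_add_norm_sub v u₀ x
    push_cast at h2
    rw [mem_closedBall_iff_norm]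
    linarith
  · intro y hy
    exact hstart y ⟨hy.1, Metric.ball_subset_ball (by linarith) hy.2⟩

/-- Near a point of the complement of a simply connected domain, a function which is subharmonic
for the random walk killed on leaving the domain decreases by a fixed factor from one scale to the
next. -/
theorem le_of_blocked (hG : G.CrossingEstimate s₀ a) {D : Set ℂ} (hDo : IsOpen D)
    (hDs : IsSimplyConnected D) {x : ℂ} (hx : x ∉ D) {W : ℝ} (hW : 640 * s₀ ≤ W)
    {h : ℂ → ℝ≥0∞} {M : ℝ≥0∞} (hM : M ≠ ∞)
    (hle : ∀ v ∈ G.verts ∩ Metric.closedBall x (32 * W), h v ≤ M)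
    {c : ℂ → ℂ → ℝ≥0∞}
    (hc : ∀ v ∈ G.verts ∩ Metric.closedBall x (22 * W), ∀ y, c v y ≤ G.q v y)
    (hcD : ∀ v ∈ G.verts ∩ Metric.closedBall x (22 * W), ∀ y, ¬ range (G.arc v y) ⊆ D → c v y = 0)
    (hsub : ∀ v ∈ G.verts ∩ Metric.closedBall x (22 * W), h v ≤ ∑' y, c v y * h y) {b : ℂ}
    (hb : b ∈ G.verts ∩ Metric.closedBall x W) : h b ≤ (1 - a ^ 82) * M := by
  classical
  have hs₀ := hG.pos
  have hbx := mem_closedBall_iff_norm.1 hb.2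
  have hstep : ∀ v ∈ G.verts ∩ Metric.closedBall x (22 * W), ∀ y, G.q v y ≠ 0 → h y ≤ M := by
    intro v hv y hq
    refine hle y ⟨mem_verts_right hq, ?_⟩
    have h1 := hG.arc_subset (weight_ne_zero_of_q hq) ⟨1, Path.target _⟩
    rw [mem_closedBall_iff_norm] at h1
    have h2 := mem_closedBall_iff_norm.1 hv.2
    have h3 := norm_sub_le_norm_sub_add_norm_sub y v x
    rw [mem_closedBall_iff_norm]
    linarith
  -- `M - h` is a supersolution that gains the full value `M` on edges leaving `D`, since `c` gives
  -- them weight zero.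
  have hg : ∀ v ∈ G.verts ∩ Metric.closedBall x (22 * W),
      ∑' y, G.q v y * (if ¬ range (G.arc v y) ⊆ D then M else M - h y) ≤ M - h v := by
    intro v hv
    have hvM := hle v ⟨hv.1, Metric.closedBall_subset_closedBall (by linarith) hv.2⟩
    refine ENNReal.le_sub_of_add_le_right (ne_top_of_le_ne_top hM hvM) ?_
    refine (add_le_add_right (hsub v hv) _).trans ?_
    rw [← ENNReal.tsum_add]
    refine le_trans (ENNReal.tsum_le_tsum fun y => ?_) (G.tsum_q_mul_le v M)
    by_cases hq : G.q v y = 0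
    · have := hc v hv y
      rw [hq, nonpos_iff_eq_zero] at this
      simp [hq, this]
    · by_cases hD : range (G.arc v y) ⊆ D
      · rw [if_neg (not_not.2 hD)]
        refine (add_le_add_right (mul_le_mul_left (hc v hv y) _) _).trans ?_
        rw [← mul_add, tsub_add_cancel_of_le (hstep v hv y hq)]
      · rw [if_pos hD, hcD v hv y hD]
        simp
  obtain ⟨e, m, he, hm, hblock⟩ := exists_blocked_corridor hDo hDs hx (W := W) (by linarith)
  have he' := dir_of_or he
  have hstart : ∀ v ∈ G.verts ∩ corridorStart e m W, a * M ≤ M - h v := by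
    intro v hv
    refine hG.le_of_uses (f := fun v => M - h v) (E := fun v y => ¬ range (G.arc v y) ⊆ D) he'
      (by linarith) ?_ hv.1 hv.2 ?_
    · intro v hv
      refine hg v ⟨hv.1, ?_⟩
      have h1 := dist_le_of_mem_corridor (norm_eq_one_of_dir he') hv.2
      have h2 := norm_sub_le_norm_sub_add_norm_sub v m x
      rw [mem_closedBall_iff_norm]
      linarith
    · intro l w hw hwR hw0
      by_contra hU
      refine hblock (G.walkPath w v l) hv.2 hw hwR ?_
      exact range_walkPath_subset (fun y y' _ _ hE => not_not.1 hE) hwR hw0 hU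
  -- The distance is at most `W + 8 * W + W = 40 * (W / 4)`, which again leads to the exponent `2 *
  -- 40 + 1`, plus one for the blocked corridor.
  have h1 : ‖m - W * e - b‖ ≤ ((40 : ℕ) : ℝ) * (W / 4) := by
    have h2 := norm_sub_le_norm_sub_add_norm_sub (m - W * e) m b
    have h3 := norm_sub_le_norm_sub_add_norm_sub m x b
    have h5 := norm_corridorStart_sub_le (s := W) (m := m) (norm_eq_one_of_dir he') (by linarith)
    rw [norm_sub_rev x] at h3
    push_cast
    linarith
  have := hG.le_of_ball (t := W / 4) (by linarith) 40 hb.1 h1 (f := fun v => M - h v)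
    (β := a * M) ?_ ?_
  · rw [← mul_assoc, ← pow_succ] at this
    have hbM := hle b ⟨hb.1, Metric.closedBall_subset_closedBall (by linarith) hb.2⟩
    rw [ENNReal.sub_mul (fun _ _ => hM), one_mul]
    refine ENNReal.le_sub_of_add_le_left ?_ ?_
    · exact ENNReal.mul_ne_top (ENNReal.pow_ne_top (ne_top_of_le_ne_top ENNReal.one_ne_top hG.le_one)) hM
    · exact (add_le_add_left this _).trans (tsub_add_cancel_of_le hbM).le
  · intro v hv
    refine le_trans (ENNReal.tsum_le_tsum fun y => ?_) (hg v ⟨hv.1, ?_⟩)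
    · gcongr
      split_ifs
      · exact le_rfl
      · exact tsub_le_self
    · have h2 := mem_closedBall_iff_norm.1 hv.2
      have h3 := norm_sub_le_norm_sub_add_norm_sub v b x
      push_cast at h2
      rw [mem_closedBall_iff_norm]
      linarith
  · intro y hy
    exact hstart y hy

/-- A function which is subharmonic for the random walk killed on leaving a simply connected domain
is small near the complement of the domain. -/
theorem le_pow_of_blocked (hG : G.CrossingEstimate s₀ a) {D : Set ℂ} (hDo : IsOpen D)
    (hDs : IsSimplyConnected D) {x : ℂ} (hx : x ∉ D) {ρ : ℝ} {k : ℕ}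
    (hW : 640 * s₀ * 32 ^ k ≤ ρ) {h : ℂ → ℝ≥0∞} (hle : ∀ v, h v ≤ 1)
    {c : ℂ → ℂ → ℝ≥0∞}
    (hc : ∀ v ∈ G.verts ∩ Metric.closedBall x ρ, ∀ y, c v y ≤ G.q v y)
    (hcD : ∀ v ∈ G.verts ∩ Metric.closedBall x ρ, ∀ y, ¬ range (G.arc v y) ⊆ D → c v y = 0)
    (hsub : ∀ v ∈ G.verts ∩ Metric.closedBall x ρ, h v ≤ ∑' y, c v y * h y) {b : ℂ}
    (hb : b ∈ G.verts ∩ Metric.closedBall x (ρ / 32 ^ k)) : h b ≤ (1 - a ^ 82) ^ k := by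
  have hs₀ := hG.pos
  induction k generalizing b with
  | zero => simpa using hle b
  | succ k ih =>
    have hρ : 0 < ρ := lt_of_lt_of_le (by positivity) hW
    have h1 : (1 : ℝ) ≤ 32 ^ k := one_le_pow₀ (by norm_num)
    have hmono : Metric.closedBall x (22 * (ρ / 32 ^ (k + 1))) ⊆ Metric.closedBall x ρ := by
      refine Metric.closedBall_subset_closedBall ?_
      rw [pow_succ, ← div_div, mul_div_assoc']
      have := div_le_self hρ.le h1
      linarith
    have hmem : ∀ v ∈ G.verts ∩ Metric.closedBall x (22 * (ρ / 32 ^ (k + 1))),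
        v ∈ G.verts ∩ Metric.closedBall x ρ := fun v hv => ⟨hv.1, hmono hv.2⟩
    rw [pow_succ']
    -- The induction hypothesis supplies the bound `M` on the ball of radius `32 * W = ρ / 32 ^ k`.
    refine hG.le_of_blocked hDo hDs hx (W := ρ / 32 ^ (k + 1)) ?_ ?_ ?_
      (fun v hv => hc v (hmem v hv)) (fun v hv => hcD v (hmem v hv))
      (fun v hv => hsub v (hmem v hv)) hb
    · rwa [le_div_iff₀ (by positivity)]
    · exact ENNReal.pow_ne_top (ne_top_of_le_ne_top ENNReal.one_ne_top tsub_le_self)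
    · intro v hv
      refine ih ?_ ⟨hv.1, ?_⟩
      · refine le_trans ?_ hW
        gcongr <;> norm_num
      · convert hv.2 using 2
        rw [pow_succ]
        field_simp

end CrossingEstimate

end PlanarGraph

/-! ## Cyclic sums over lists -/

/-- Each rotation permutes the lists of a given length, so after exchanging the sums every `L`
contributes `g L / L.length` exactly `L.length` times. This trades the factor `1 / p` for a choice
of root. -/
theorem tsum_rotate_div_length_le {α : Type*} (f g : List α → ℝ≥0∞)
    (hfg : ∀ L, f L ≤ ∑ j ∈ Finset.range L.length, g (L.rotate j)) :
    ∑' L, f L / (L.length : ℝ≥0∞) ≤ ∑' L, g L := by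
  have hbij : ∀ j : ℕ, Function.Bijective fun L : List α => L.rotate j := fun j => by
    refine ⟨List.rotate_injective j, fun L => ?_⟩
    obtain ⟨k, hk⟩ := List.IsRotated.symm (⟨j, rfl⟩ : L ~r L.rotate j)
    refine ⟨L.rotate k, ?_⟩
    have h : (L.rotate j).rotate k = L := hk
    change (L.rotate k).rotate j = L
    rw [List.rotate_rotate] at h ⊢
    rwa [add_comm]
  calc ∑' L, f L / (L.length : ℝ≥0∞)
      ≤ ∑' (L : List α) (j : ℕ), (if j < L.length then g (L.rotate j) / (L.length : ℝ≥0∞) else 0) := by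
        refine ENNReal.tsum_le_tsum fun L => ?_
        rw [tsum_eq_sum (s := Finset.range L.length)
          (fun j hj => if_neg (by simpa using hj))]
        rw [Finset.sum_congr rfl fun j hj => if_pos (Finset.mem_range.1 hj)]
        simp only [div_eq_mul_inv]
        rw [← Finset.sum_mul]
        gcongr
        exact hfg L
    _ = ∑' (j : ℕ) (L : List α), (if j < L.length then g L / (L.length : ℝ≥0∞) else 0) := by
        rw [ENNReal.tsum_comm]
        refine tsum_congr fun j => ?_
        simpa using (Equiv.ofBijective _ (hbij j)).tsum_eq
          fun L => if j < L.length then g L / (L.length : ℝ≥0∞) else 0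
    _ = ∑' (L : List α) (j : ℕ), (if j < L.length then g L / (L.length : ℝ≥0∞) else 0) :=
        ENNReal.tsum_comm
    _ ≤ ∑' L, g L := by
        refine ENNReal.tsum_le_tsum fun L => ?_
        rw [tsum_eq_sum (s := Finset.range L.length)
          (fun j hj => if_neg (by simpa using hj))]
        rw [Finset.sum_congr rfl fun j hj => if_pos (Finset.mem_range.1 hj)]
        simp only [Finset.sum_const, Finset.card_range, nsmul_eq_mul]
        exact ENNReal.mul_div_le

theorem List.exists_first {α : Type*} {P : α → Prop} {L : List α} (h : ∃ x ∈ L, P x) :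
    ∃ l₁ x l₂, L = l₁ ++ x :: l₂ ∧ P x ∧ ∀ y ∈ l₁, ¬ P y := by
  classical
  induction L with
  | nil => simp at h
  | cons y L ih =>
    by_cases hy : P y
    · exact ⟨[], y, L, rfl, hy, by simp⟩
    · obtain ⟨l₁, x, l₂, rfl, hx, hl⟩ := ih (by simpa [hy] using h)
      exact ⟨y :: l₁, x, l₂, rfl, hx, by simpa [hy] using hl⟩

/-- The weight of a walk, for a kernel `c`: the product of the values of `c` along the walk from `u`
through the points of the list to `w`. -/
def walkWeight {α : Type*} (c : α → α → ℝ≥0∞) (w u : α) (l : List α) : ℝ≥0∞ :=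
  listWeight (fun v => c v w) c (fun _ y => y) u l

/-- The weight of a cyclic list. -/
def cycleWeight {α : Type*} (c : α → α → ℝ≥0∞) (L : List α) : ℝ≥0∞ :=
  (L.zipWith c (L.rotate 1)).prod

theorem cycleWeight_rotate {α : Type*} (c : α → α → ℝ≥0∞) (L : List α) (n : ℕ) :
    cycleWeight c (L.rotate n) = cycleWeight c L := by
  rw [cycleWeight, List.rotate_rotate, add_comm, ← List.rotate_rotate,
    ← List.zipWith_rotate_distrib _ _ _ _ (by simp)]
  exact (List.rotate_perm _ _).prod_eq

theorem cycleWeight_cons {α : Type*} (c : α → α → ℝ≥0∞) (u : α) (l : List α) :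
    cycleWeight c (u :: l) = walkWeight c u u l := by
  have : ∀ w u, (List.zipWith c (u :: l) (l ++ [w])).prod = walkWeight c w u l := by
    intro w
    induction l with
    | nil => intro u; simp [walkWeight, listWeight]
    | cons y l ih => intro u; simpa [walkWeight, listWeight] using congrArg (c u y * ·) (ih y)
  simpa [cycleWeight] using this u u

/-! ## Alternating visits to two sets -/

section Entrance

variable {α : Type*} (c : α → α → ℝ≥0∞) (A B : Set α)

/-- The expected number of points of `A` hit first, by the Markov chain with transition weights
`c`. -/
def hitMass : α → ℝ≥0∞ :=
  open Classical in
  listSum (fun v => ∑' y, if y ∈ A then c v y else 0) (fun v y => if y ∈ A then 0 else c v y)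
    (fun _ y => y)

/-- The transitions of the chain which records, besides its position, whether the set to be visited
next is `A` (`True`) or `B` (`False`). -/
def entranceNext (x : Prop × α) (y : α) : Prop × α := ((x.1 ∧ y ∉ A) ∨ (¬ x.1 ∧ y ∈ B), y)

/-- The weight of the last step of a walk which enters `A` at `u` after visiting `B`. -/
def entranceWeight (u : α) (x : Prop × α) : ℝ≥0∞ :=
  open Classical in if x.1 ∧ u ∈ A then c x.2 u else 0

/-- The expected number of entrances into `A` at `u` after a visit to `B`. -/
def entranceMass (u : α) : Prop × α → ℝ≥0∞ :=
  listSum (entranceWeight c A u) (fun x y => c x.2 y) (entranceNext A B)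

variable {c A B}

open Classical in
theorem hitMass_eq (v : α) :
    hitMass c A v = ∑' y, c v y * (if y ∈ A then 1 else hitMass c A y) := by
  rw [hitMass, listSum_eq, ← ENNReal.tsum_add]
  refine tsum_congr fun y => ?_
  by_cases hy : y ∈ A <;> simp [hy]

theorem hitMass_le_one (hc : ∀ v, ∑' y, c v y ≤ 1) (v : α) : hitMass c A v ≤ 1 := by
  refine listSum_le (f := fun _ => 1) (fun v => ?_) v
  rw [← ENNReal.tsum_add]
  refine le_trans (ENNReal.tsum_le_tsum fun y => ?_) (hc v)
  by_cases hy : y ∈ A <;> simp [hy]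

theorem listWeight_tsum {X Y ι : Type*} (t : ι → X → ℝ≥0∞) (c : X → Y → ℝ≥0∞) (nx : X → Y → X)
    (x : X) (l : List Y) :
    listWeight (fun x => ∑' i, t i x) c nx x l = ∑' i, listWeight (t i) c nx x l := by
  induction l generalizing x with
  | nil => rfl
  | cons y l ih => simp only [listWeight, ih, ENNReal.tsum_mul_left]

-- `X` bounds the expected number of entrances when `B` is to be visited next. After `B`, another
-- entrance requires hitting `A`, and then counts one plus at most `X`. The hypothesis on `X` says
-- that these bounds form a supersolution.
open Classical in
theorem tsum_entranceMass_le (hc : ∀ v, ∑' y, c v y ≤ 1) {X : ℝ≥0∞}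
    (hX : ∀ b ∈ B, (1 + X) * hitMass c A b ≤ X) (x : Prop × α) :
    ∑' u, entranceMass c A B u x ≤ if x.1 then (1 + X) * hitMass c A x.2 else X := by
  have h : ∑' u, entranceMass c A B u x =
      listSum (fun x => ∑' u, entranceWeight c A u x) (fun x y => c x.2 y) (entranceNext A B) x := by
    simp only [entranceMass, listSum, listWeight_tsum]
    exact ENNReal.tsum_comm
  rw [h]
  refine listSum_le (f := fun x => if x.1 then (1 + X) * hitMass c A x.2 else X) ?_ x
  rintro ⟨b, v⟩
  rw [← ENNReal.tsum_add]
  by_cases hb : b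
  · simp only [hb, entranceWeight, entranceNext, true_and, not_true, false_and, or_false, if_true]
    rw [hitMass_eq, ← ENNReal.tsum_mul_left]
    refine ENNReal.tsum_le_tsum fun y => ?_
    by_cases hy : y ∈ A
    · simp only [hy, if_true, not_true, if_false]
      exact le_of_eq (by ring)
    · simp only [hy, if_false, not_false_iff, if_true]
      exact le_of_eq (by ring)
  · simp only [hb, entranceWeight, entranceNext, false_and, not_false_iff, true_and, false_or,
      if_false, zero_add]
    refine (ENNReal.tsum_le_tsum fun y => mul_le_mul_right (b := _) (c := X) ?_ (c v y)).trans ?_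
    · split_ifs with hy
      · exact hX y hy
      · exact le_rfl
    · rw [ENNReal.tsum_mul_right]
      exact mul_le_of_le_one_left' (hc v)

/-- Where the starting point is not in `B`, this is harmonicity in the starting point, the form in
which the Harnack inequality is applied. -/
theorem entranceMass_false_eq (u v : α) :
    entranceMass c A B u (False, v) = ∑' y, c v y * entranceMass c A B u (y ∈ B, y) := by
  rw [entranceMass, listSum_eq]
  simp [entranceWeight, entranceNext]

theorem entranceMass_eq_zero {u : α} (hu : u ∉ A) (x : Prop × α) :
    entranceMass c A B u x = 0 := by
  rw [← nonpos_iff_eq_zero]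
  exact listSum_le (f := fun _ => 0) (by simp [entranceWeight, hu]) x

theorem listWeight_entrance (u v : α) (b : Prop) (l : List α) :
    listWeight (entranceWeight c A u) (fun x y => c x.2 y) (entranceNext A B) (b, v) l =
      open Classical in if List.foldl (fun b y => (b ∧ y ∉ A) ∨ (¬ b ∧ y ∈ B)) b l ∧ u ∈ A then
        walkWeight c u v l else 0 := by
  induction l generalizing b v with
  | nil =>
    simp only [listWeight, entranceWeight, walkWeight, List.foldl_nil]
    congr
  | cons y l ih =>
    simp only [listWeight, entranceNext, ih, List.foldl_cons, walkWeight, mul_ite, mul_zero]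
    congr

open Classical in
/-- The mass of the cyclic lists visiting both `A` and `B` is at most the expected number of
entrances into `A`, after a visit to `B`, which happen at the starting point. -/
theorem tsum_cycleWeight_le (hAB : Disjoint A B) :
    ∑' L : List α, (if (∃ x ∈ L, x ∈ A) ∧ ∃ y ∈ L, y ∈ B then cycleWeight c L else 0) /
      (L.length : ℝ≥0∞) ≤ ∑' u, entranceMass c A B u (False, u) := by
  let g : List α → ℝ≥0∞ := fun L => match L with
    | [] => 0
    | u :: l => listWeight (entranceWeight c A u) (fun x y => c x.2 y) (entranceNext A B)
        (False, u) l
  have hg : ∑' L, g L = ∑' u, entranceMass c A B u (False, u) := by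
    rw [tsum_list]; simp [g, entranceMass, listSum]
  rw [← hg]
  refine tsum_rotate_div_length_le _ g fun L => ?_
  split_ifs with h
  swap
  · exact zero_le
  obtain ⟨⟨x, hxL, hx⟩, y, hyL, hy⟩ := h
  have hlen : 0 < L.length := List.length_pos_of_mem hxL
  suffices ∃ j, cycleWeight c L ≤ g (L.rotate j) by
    obtain ⟨j, hj⟩ := this
    rw [← List.rotate_mod] at hj
    exact hj.trans (Finset.single_le_sum (f := fun j => g (L.rotate j)) (fun _ _ => zero_le)
      (Finset.mem_range.2 (Nat.mod_lt _ hlen)))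
  -- The new root is the first point `z` of `A` met cyclically after a point `y` of `B`. Between `y`
  -- and `z` the flag stays at "`A` is next", so the step that closes the cycle is an entrance at
  -- `z`.
  obtain ⟨s, t, rfl⟩ := List.append_of_mem hyL
  obtain ⟨l₁, z, l₂, hm, hz, hl₁⟩ := List.exists_first (P := (· ∈ A)) (L := t ++ s)
    ⟨x, by
      have : x ≠ y := fun h => hAB.ne_of_mem hx hy h
      simp only [List.mem_append, List.mem_cons, this, false_or] at hxL ⊢
      tauto, hx⟩
  refine ⟨s.length + (y :: l₁).length, ?_⟩
  have h1 : (s ++ y :: t).rotate (s.length + (y :: l₁).length) = z :: l₂ ++ y :: l₁ := by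
    rw [← List.rotate_rotate, List.rotate_append_length_eq, List.cons_append, hm,
      ← List.cons_append, List.rotate_append_length_eq]
  rw [← cycleWeight_rotate c _ (s.length + (y :: l₁).length), h1, List.cons_append]
  simp only [g]
  rw [listWeight_entrance, if_pos, cycleWeight_cons]
  refine ⟨?_, hz⟩
  have hyA : y ∉ A := fun h => hAB.ne_of_mem h hy rfl
  have hT : ∀ l : List α, (∀ w ∈ l, w ∉ A) →
      List.foldl (fun b y => (b ∧ y ∉ A) ∨ (¬ b ∧ y ∈ B)) True l := by
    intro l
    induction l with
    | nil => simp
    | cons w l ih =>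
      intro h
      simp only [List.mem_cons, forall_eq_or_imp] at h
      simpa [h.1] using ih h.2
  rw [List.foldl_append, List.foldl_cons]
  have : ∀ b : Prop, ((b ∧ y ∉ A) ∨ (¬ b ∧ y ∈ B)) = True := fun b => by
    simp only [eq_iff_iff, iff_true]; tauto
  rw [this]
  exact hT l₁ hl₁

end Entrance

/-! ## Open sets of loops -/

theorem ParamLoop.exists_edist_lt {f g : ParamLoop} {r : ℝ≥0∞} (h : edist f g < r) (t : ℝ) :
    ∃ s, edist (f.toFun t) (g.toFun s) < r := by
  rw [ParamLoop.edist_def, iInf_lt_iff] at h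
  obtain ⟨φ, hφ⟩ := h
  exact ⟨φ t, (le_iSup (fun s : ℝ => edist (f.toFun s) (g.toFun (φ s))) t).trans_lt hφ⟩

namespace UnrootedLoop

theorem trace_mk (f : ParamLoop) : trace (SeparationQuotient.mk f) = range f.toFun := rfl

theorem isOpen_of_param {P : Set ℂ → Prop}
    (h : ∀ f : ParamLoop, P (range f.toFun) →
      ∃ r > 0, ∀ g : ParamLoop, edist g f < r → P (range g.toFun)) :
    IsOpen {l : UnrootedLoop | P l.trace} := by
  rw [← SeparationQuotient.isQuotientMap_mk.isOpen_preimage, EMetric.isOpen_iff]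
  intro f hf
  obtain ⟨r, hr, h⟩ := h f hf
  exact ⟨r, hr, fun g hg => h g hg⟩

theorem isOpen_loopsIn {D : Set ℂ} (hD : IsOpen D) : IsOpen (loopsIn D) := by
  refine isOpen_of_param (P := fun S => S ⊆ D) fun f hf => ?_
  have hc : IsCompact (range f.toFun) := by
    rw [← f.periodic'.image_Icc one_pos 0]
    exact isCompact_Icc.image f.continuous'
  obtain ⟨r, hr, h⟩ := hc.exists_thickening_subset_open hD hf
  refine ⟨ENNReal.ofReal r, by simpa using hr, fun g hg => ?_⟩
  rintro _ ⟨t, rfl⟩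
  obtain ⟨s, hs⟩ := ParamLoop.exists_edist_lt hg t
  refine h (Metric.mem_thickening_iff.2 ⟨_, mem_range_self s, ?_⟩)
  rwa [edist_dist, ENNReal.ofReal_lt_ofReal_iff hr] at hs

theorem isOpen_meets {O : Set ℂ} (hO : IsOpen O) :
    IsOpen {l : UnrootedLoop | (l.trace ∩ O).Nonempty} := by
  refine isOpen_of_param (P := fun S => (S ∩ O).Nonempty) fun f hf => ?_
  obtain ⟨_, ⟨t, rfl⟩, ht⟩ := hf
  obtain ⟨r, hr, h⟩ := EMetric.isOpen_iff.1 hO _ ht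
  refine ⟨r, hr, fun g hg => ?_⟩
  rw [edist_comm] at hg
  obtain ⟨s, hs⟩ := ParamLoop.exists_edist_lt hg t
  exact ⟨_, mem_range_self s, h (by rwa [edist_comm] at hs)⟩

/-- The strict inequality makes the condition open, hence Borel; the diameters in the main statement
are compared with it at half the size. -/
theorem isOpen_large (κ : ℝ) :
    IsOpen {l : UnrootedLoop | ∃ p ∈ l.trace, ∃ q ∈ l.trace, κ < dist p q} := by
  refine isOpen_of_param (P := fun S => ∃ p ∈ S, ∃ q ∈ S, κ < dist p q) fun f hf => ?_
  obtain ⟨_, ⟨t, rfl⟩, _, ⟨t', rfl⟩, ht⟩ := hf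
  set d := dist (f.toFun t) (f.toFun t') - κ with hd
  have hd0 : 0 < d := sub_pos.2 ht
  refine ⟨ENNReal.ofReal (d / 2), by simpa using hd0, fun g hg => ?_⟩
  rw [edist_comm] at hg
  obtain ⟨s, hs⟩ := ParamLoop.exists_edist_lt hg t
  obtain ⟨s', hs'⟩ := ParamLoop.exists_edist_lt hg t'
  rw [edist_dist, ENNReal.ofReal_lt_ofReal_iff (by linarith)] at hs hs'
  refine ⟨_, mem_range_self s, _, mem_range_self s', ?_⟩
  have h1 := dist_triangle4 (f.toFun t) (g.toFun s) (g.toFun s') (f.toFun t')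
  rw [dist_comm (g.toFun s') (f.toFun t')] at h1
  linarith

theorem exists_lt_dist_of_lt_diam {l : UnrootedLoop} {κ : ℝ} (hκ : 0 ≤ κ)
    (h : κ < Metric.diam l.trace) : ∃ p ∈ l.trace, ∃ q ∈ l.trace, κ < dist p q := by
  by_contra! hcon
  exact absurd (Metric.diam_le_of_forall_dist_le hκ hcon) (not_le.2 h)

theorem trace_ofPath {x : ℂ} (p : Path x x) :
    trace (SeparationQuotient.mk (ParamLoop.ofPath p)) = range p := by
  rw [trace_mk]
  refine Subset.antisymm ?_ ?_
  · rintro _ ⟨t, rfl⟩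
    exact ⟨projIcc 0 1 zero_le_one (Int.fract t), rfl⟩
  · rintro _ ⟨t, rfl⟩
    rcases eq_or_ne t 1 with rfl | ht
    · exact ⟨0, by simp [ParamLoop.ofPath]⟩
    · refine ⟨t, ?_⟩
      have : Int.fract (t : ℝ) = t := Int.fract_eq_self.2
        ⟨t.2.1, lt_of_le_of_ne t.2.2 fun h => ht (Subtype.ext h)⟩
      simp [ParamLoop.ofPath, this]

/-- The loops which meet `O` and have two points at distance larger than `κ`. -/
def largeMeeting (O : Set ℂ) (κ : ℝ) : Set UnrootedLoop :=
  {l | (l.trace ∩ O).Nonempty} ∩ {l | ∃ p ∈ l.trace, ∃ q ∈ l.trace, κ < dist p q}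

theorem measurableSet_largeMeeting {O : Set ℂ} (hO : IsOpen O) (κ : ℝ) :
    MeasurableSet (largeMeeting O κ) :=
  ((isOpen_meets hO).inter (isOpen_large κ)).measurableSet

end UnrootedLoop

/-! ## Large loops near the boundary -/

namespace PlanarGraph

variable {G : PlanarGraph} {s₀ : ℝ} {a : ℝ≥0∞}

theorem loopMeasure_apply {S : Set UnrootedLoop} (hS : MeasurableSet S) :
    G.loopMeasure S = ∑' x : ℂ × List ℂ,
      G.rootedMass x.1 x.2 * S.indicator 1 (G.toUnrootedLoop x.1 x.2) := by
  rw [loopMeasure, Measure.sum_apply _ hS]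
  simp [Measure.dirac_apply' _ hS]

theorem trace_toUnrootedLoop (u : ℂ) (l : List ℂ) :
    (G.toUnrootedLoop u l).trace = range (G.walkPath u u l) :=
  UnrootedLoop.trace_ofPath _

theorem walkWeight_eq_walkProb {c : ℂ → ℂ → ℝ≥0∞} {D : Set ℂ}
    (hc : ∀ u v, range (G.arc u v) ⊆ D → c u v = G.q u v) {w u : ℂ} {l : List ℂ}
    (h : range (G.walkPath w u l) ⊆ D) : walkWeight c w u l = G.walkProb w u l := by
  induction l generalizing u with
  | nil => exact hc _ _ h
  | cons v l ih =>
    rw [range_walkPath_cons, union_subset_iff] at h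
    exact congrArg₂ (· * ·) (hc _ _ h.1) (ih h.2)

/-- Edges are short. The vertex lies on the trace, so it belongs to `D` when the loop stays in `D`.
-/
theorem CrossingEstimate.exists_vertex_near (hG : G.CrossingEstimate s₀ a) {w u : ℂ} {l : List ℂ}
    (h : G.walkProb w u l ≠ 0) {p : ℂ} (hp : p ∈ range (G.walkPath w u l)) :
    ∃ v ∈ u :: l, v ∈ G.verts ∧ v ∈ range (G.walkPath w u l) ∧ ‖p - v‖ ≤ 640 * s₀ := by
  induction l generalizing u with
  | nil =>
    have hq : G.q u w ≠ 0 := h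
    exact ⟨u, by simp, mem_verts_left hq, source_mem_range_walkPath _ _ _,
      mem_closedBall_iff_norm.1 (hG.arc_subset (weight_ne_zero_of_q hq) hp)⟩
  | cons y l ih =>
    simp only [walkProb, ne_eq, mul_eq_zero, not_or] at h
    rw [range_walkPath_cons] at hp ⊢
    rcases hp with hp | hp
    · exact ⟨u, by simp, mem_verts_left h.1, Or.inl ⟨0, Path.source _⟩,
        mem_closedBall_iff_norm.1 (hG.arc_subset (weight_ne_zero_of_q h.1) hp)⟩
    · obtain ⟨v, hv, h1, h2, h3⟩ := ih h.2 hp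
      exact ⟨v, List.mem_cons_of_mem _ hv, h1, Or.inr h2, h3⟩

open Classical in
/-- The transition weights of the random walk which is killed on leaving `D`, except inside the
set `U`. -/
def killed (G : PlanarGraph) (D U : Set ℂ) (v y : ℂ) : ℝ≥0∞ :=
  if v ∈ U ∨ range (G.arc v y) ⊆ D then G.q v y else 0

theorem killed_le_q (D U : Set ℂ) (v y : ℂ) : G.killed D U v y ≤ G.q v y := by
  rw [killed]; split_ifs <;> simp

theorem tsum_killed_le (D U : Set ℂ) (v : ℂ) : ∑' y, G.killed D U v y ≤ 1 :=
  (ENNReal.tsum_le_tsum (killed_le_q D U v)).trans (G.tsum_q_le v)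

/-- The expected number of returns to a set `A` after a visit to the neighbourhood `B` of the
boundary of a simply connected domain. -/
theorem CrossingEstimate.tsum_entranceMass_le (hG : G.CrossingEstimate s₀ a) {D : Set ℂ}
    (hDo : IsOpen D) (hDs : IsSimplyConnected D) {x : ℂ} {r η : ℝ} {k : ℕ}
    (hη : η = r / (4 * 32 ^ k)) (hs : 640 * s₀ ≤ η) {A B : Set ℂ}
    (hA : A = G.verts ∩ Metric.closedBall x (r / 2))
    (hB : B = {v ∈ G.verts | v ∉ Metric.closedBall x (13 * r) ∧
      ∃ x₀ ∈ frontier D, dist v x₀ < 2 * η})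
    {p : ℝ≥0∞} (hp : p = (1 - a ^ 82) ^ k) (hp2 : p ≤ 1 / 2) :
    ∑' u, entranceMass (G.killed D (Metric.closedBall x (12 * r))) A B u (False, u) ≤
      2 * p / a ^ 82 := by
  classical
  have hs₀ := hG.pos
  have h32 : (1 : ℝ) ≤ 32 ^ k := one_le_pow₀ (by norm_num)
  have hrη : r = 4 * 32 ^ k * η := by rw [hη]; field_simp
  have hη0 : 0 < η := by linarith
  have hr : 4 * η ≤ r := by rw [hrη]; nlinarith
  set c := G.killed D (Metric.closedBall x (12 * r)) with hcdef
  have hc1 : ∀ v, ∑' y, c v y ≤ 1 := tsum_killed_le _ _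
  have hBA : ∀ v ∈ Metric.closedBall x (12 * r), v ∉ B := by
    intro v hv hvB
    rw [hB] at hvB
    exact hvB.2.1 (Metric.closedBall_subset_closedBall (by linarith) hv)
  -- Around the boundary point near `b`, the ball of radius `r / 2` avoids `A` and the ball of
  -- radius `12 * r` where killing is suspended. The walk from `b` has `k` scales to get through,
  -- since `2 * η = r / 2 / 32 ^ k`.
  have hit : ∀ b ∈ B, hitMass c A b ≤ p := by
    intro b hb
    rw [hB] at hb
    obtain ⟨hbv, hbx, x₀, hx₀, hbx₀⟩ := hb
    rw [mem_closedBall_iff_norm, not_le] at hbx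
    rw [dist_eq_norm] at hbx₀
    have hx₀D : x₀ ∉ D := fun h => hDo.inter_frontier_eq.subset ⟨h, hx₀⟩
    have hfar : ∀ v ∈ Metric.closedBall x₀ (r / 2), v ∉ Metric.closedBall x (12 * r) := by
      intro v hv hv'
      rw [mem_closedBall_iff_norm] at hv hv'
      have h1 := norm_sub_le_norm_sub_add_norm_sub b x₀ x
      have h2 := norm_sub_le_norm_sub_add_norm_sub x₀ v x
      rw [norm_sub_rev x₀ v] at h2
      linarith
    have hfarA : ∀ v ∈ Metric.closedBall x₀ (r / 2), v ∉ A := by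
      intro v hv hvA
      rw [hA] at hvA
      exact hfar v hv (Metric.closedBall_subset_closedBall (by linarith) hvA.2)
    have hb1 : b ∈ Metric.closedBall x₀ (r / 2 / 32 ^ k) := by
      rw [mem_closedBall_iff_norm]
      refine hbx₀.le.trans (le_of_eq ?_)
      rw [hrη]; field_simp; ring
    have hb2 : b ∈ Metric.closedBall x₀ (r / 2) := by
      rw [mem_closedBall_iff_norm]; linarith
    have := hG.le_pow_of_blocked hDo hDs hx₀D (ρ := r / 2) (k := k) ?_
      (h := fun v => if v ∈ A then 1 else hitMass c A v) ?_ (c := c)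
      (fun v _ y => killed_le_q _ _ v y) ?_ ?_ ⟨hbv, hb1⟩
    · simpa only [hfarA b hb2, if_false, ← hp] using this
    · rw [hrη]
      nlinarith
    · intro v
      split_ifs
      · exact le_rfl
      · exact hitMass_le_one hc1 v
    · intro v hv y hy
      simp [hcdef, killed, hy, hfar v hv.2]
    · intro v hv
      simp only [hfarA v hv.2, if_false]
      exact (hitMass_eq v).le
  -- `X = 2 * p` works in the geometric series bound because `1 + 2 * p ≤ 2`.
  have hX : ∀ b ∈ B, (1 + 2 * p) * hitMass c A b ≤ 2 * p := by
    intro b hb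
    calc (1 + 2 * p) * hitMass c A b ≤ (1 + 2 * (1 / 2)) * p := by
          gcongr
          exact hit b hb
      _ = 2 * p := by
          rw [one_div, ENNReal.mul_inv_cancel (by simp) (by simp)]
          norm_num
  have hsum := _root_.tsum_entranceMass_le hc1 hX
  have hpt : p ≠ ∞ := ne_top_of_le_ne_top (by simp) hp2
  have hfin : ∀ u y, entranceMass c A B u y ≠ ∞ := by
    intro u y
    refine ne_top_of_le_ne_top ?_ ((ENNReal.le_tsum u).trans (hsum y))
    have h2p : 2 * p ≠ ∞ := ENNReal.mul_ne_top (by simp) hpt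
    split_ifs
    · exact ENNReal.mul_ne_top (ENNReal.add_ne_top.2 ⟨by simp, h2p⟩)
        (ne_top_of_le_ne_top (by simp) (hitMass_le_one hc1 _))
    · exact h2p
  have ha : a ^ 82 ≠ 0 := pow_ne_zero _ hG.ne_zero
  have hat : a ^ 82 ≠ ∞ := ENNReal.pow_ne_top (ne_top_of_le_ne_top ENNReal.one_ne_top hG.le_one)
  rw [ENNReal.le_div_iff_mul_le (Or.inl ha) (Or.inl hat), mul_comm, ← ENNReal.tsum_mul_left]
  rcases A.eq_empty_or_nonempty with hAe | ⟨u₀, hu₀⟩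
  · simp [entranceMass_eq_zero, hAe]
  -- The Harnack inequality moves the start of each term from `u` to `u₀`, after which the sum
  -- counts all entrances of one walk.
  refine le_trans (ENNReal.tsum_le_tsum fun u => ?_) ((hsum (False, u₀)).trans (by simp))
  by_cases hu : u ∈ A
  swap
  · simp [entranceMass_eq_zero hu]
  rw [hA] at hu hu₀
  have hsub : Metric.closedBall x (r / 2) ⊆ Metric.closedBall x (12 * r) :=
    Metric.closedBall_subset_closedBall (by linarith)
  have := hG.harnack (x := x) (r := r) (by linarith)
    (h := fun y => entranceMass c A B u (y ∈ B, y)) (fun v => hfin u _) ?_ hu hu₀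
  · simpa only [hBA u (hsub hu.2), hBA u₀ (hsub hu₀.2)] using this
  · intro v hv
    simp only [hBA v hv.2]
    rw [entranceMass_false_eq]
    refine tsum_congr fun y => ?_
    rw [hcdef, killed, if_pos (Or.inl hv.2)]

/-- The mass of the large loops in a simply connected domain which come close to its boundary. -/
theorem CrossingEstimate.loopMeasureIn_le (hG : G.CrossingEstimate s₀ a) {D : Set ℂ}
    (hDo : IsOpen D) (hDs : IsSimplyConnected D) {F : Finset ℂ} {r η : ℝ}
    (hF : D ⊆ ⋃ x ∈ F, Metric.closedBall x (r / 2)) {k : ℕ}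
    (hη : η = r / (4 * 32 ^ k)) (hs : 640 * s₀ ≤ η)
    {p : ℝ≥0∞} (hp : p = (1 - a ^ 82) ^ k) (hp2 : p ≤ 1 / 2) :
    G.loopMeasureIn D (UnrootedLoop.largeMeeting (Metric.thickening η (frontier D)) (30 * r)) ≤
      F.card * (2 * p / a ^ 82) := by
  classical
  have hs₀ := hG.pos
  have h32 : (1 : ℝ) ≤ 32 ^ k := one_le_pow₀ (by norm_num)
  have hη0 : 0 < η := by linarith
  have hr : 4 * η ≤ r := by
    have hrη : r = 4 * 32 ^ k * η := by rw [hη]; field_simp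
    rw [hrη]; nlinarith
  let A : ℂ → Set ℂ := fun x => G.verts ∩ Metric.closedBall x (r / 2)
  let B : ℂ → Set ℂ := fun x => {v ∈ G.verts | v ∉ Metric.closedBall x (13 * r) ∧
      ∃ x₀ ∈ frontier D, dist v x₀ < 2 * η}
  let c : ℂ → ℂ → ℂ → ℝ≥0∞ := fun x => G.killed D (Metric.closedBall x (12 * r))
  have hAB : ∀ x, Disjoint (A x) (B x) := fun x => by
    rw [Set.disjoint_left]
    intro v hvA hvB
    exact hvB.2.1 (Metric.closedBall_subset_closedBall (by linarith) hvA.2)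
  let m : ℂ → List ℂ → ℝ≥0∞ := fun x L =>
    (if (∃ y ∈ L, y ∈ A x) ∧ ∃ y ∈ L, y ∈ B x then cycleWeight (c x) L else 0) /
      (L.length : ℝ≥0∞)
  have hmeas := UnrootedLoop.measurableSet_largeMeeting
    (Metric.isOpen_thickening (δ := η) (E := frontier D)) (30 * r)
  have hD := (UnrootedLoop.isOpen_loopsIn hDo).measurableSet
  rw [loopMeasureIn, Measure.restrict_apply hmeas, loopMeasure_apply (hmeas.inter hD)]
  have hinj : Function.Injective fun y : ℂ × List ℂ => y.1 :: y.2 := by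
    rintro ⟨u, l⟩ ⟨v, l'⟩ h
    simpa using h
  have hpt : ∀ y : ℂ × List ℂ, G.rootedMass y.1 y.2 *
      indicator (UnrootedLoop.largeMeeting (Metric.thickening η (frontier D)) (30 * r) ∩ loopsIn D)
        1 (G.toUnrootedLoop y.1 y.2) ≤ ∑ x ∈ F, m x (y.1 :: y.2) := by
    rintro ⟨u, l⟩
    by_cases hmem : G.toUnrootedLoop u l ∈
      UnrootedLoop.largeMeeting (Metric.thickening η (frontier D)) (30 * r) ∩ loopsIn D
    swap
    · simp [hmem]
    by_cases h0 : G.walkProb u u l = 0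
    · simp [rootedMass, h0]
    rw [indicator_of_mem hmem, Pi.one_apply, mul_one]
    obtain ⟨⟨hmeet, hlarge⟩, hin⟩ := hmem
    simp only [loopsIn, mem_ofPred_eq] at hmeet hlarge hin
    rw [trace_toUnrootedLoop] at hmeet hlarge hin
    obtain ⟨z, hz, hzt⟩ := hmeet
    obtain ⟨x₀, hx₀, hzx₀⟩ := Metric.mem_thickening_iff.1 hzt
    obtain ⟨b, hbl, hbv, hbD, hzb⟩ := hG.exists_vertex_near h0 hz
    -- One of two points more than `30 * r` apart is more than `15 * r` from `b`. Passing to a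
    -- vertex and then to a centre of the cover loses at most `r / 4 + r / 2`, so `b` is more than
    -- `13 * r` from the centre.
    have hfar : ∃ z' ∈ range (G.walkPath u u l), 15 * r < ‖z' - b‖ := by
      obtain ⟨z₁, hz₁, z₂, hz₂, hzz⟩ := hlarge
      by_contra! hcon
      have h1 := hcon z₁ hz₁
      have h2 := hcon z₂ hz₂
      rw [dist_eq_norm] at hzz
      have h3 := norm_sub_le_norm_sub_add_norm_sub z₁ b z₂
      rw [norm_sub_rev b] at h3
      linarith
    obtain ⟨z', hz', hz'b⟩ := hfar
    obtain ⟨v, hvl, hvv, hvD, hz'v⟩ := hG.exists_vertex_near h0 hz'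
    obtain ⟨x, hxF, hvx⟩ := mem_iUnion₂.1 (hF (hin hvD))
    have hvA : v ∈ A x := ⟨hvv, hvx⟩
    have hbB : b ∈ B x := by
      refine ⟨hbv, fun hbx => ?_, x₀, hx₀, ?_⟩
      · rw [mem_closedBall_iff_norm] at hbx hvx
        have h1 := norm_sub_le_norm_sub_add_norm_sub z' v b
        have h2 := norm_sub_le_norm_sub_add_norm_sub v x b
        rw [norm_sub_rev x b] at h2
        linarith
      · have h1 := dist_triangle b z x₀
        rw [dist_comm b z, dist_eq_norm z b] at h1
        linarith
    refine le_trans (le_of_eq ?_) (Finset.single_le_sum (f := fun x => m x (u :: l))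
      (fun _ _ => zero_le) hxF)
    simp only [m]
    rw [if_pos ⟨⟨v, hvl, hvA⟩, b, hbl, hbB⟩, cycleWeight_cons, rootedMass,
      walkWeight_eq_walkProb (c := c x) (D := D) (fun u v h => if_pos (Or.inr h)) hin, List.length_cons]
  calc _ ≤ ∑' y : ℂ × List ℂ, ∑ x ∈ F, m x (y.1 :: y.2) := ENNReal.tsum_le_tsum hpt
    _ ≤ ∑' L : List ℂ, ∑ x ∈ F, m x L :=
        ENNReal.tsum_comp_le_tsum_of_injective hinj fun L => ∑ x ∈ F, m x L
    _ = ∑ x ∈ F, ∑' L : List ℂ, m x L := Summable.tsum_finsetSum fun _ _ => ENNReal.summable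
    _ ≤ ∑ x ∈ F, 2 * p / a ^ 82 := by
        refine Finset.sum_le_sum fun x _ => ?_
        refine le_trans (le_of_eq (tsum_congr fun L => ?_))
          ((tsum_cycleWeight_le (c := c x) (hAB x)).trans (hG.tsum_entranceMass_le hDo hDs hη hs rfl rfl hp hp2))
        simp only [m]
        congr
    _ = F.card * (2 * p / a ^ 82) := by simp

/-! ## The crossing estimate in centred form -/

theorem image_affine {s : ℝ} (hs : s ≠ 0) (z : ℂ) (S : Set ℂ) :
    (fun x : ℂ => (s : ℂ) * x + z) '' S = {y | (y - z) / s ∈ S} := by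
  have hs' : (s : ℂ) ≠ 0 := by exact_mod_cast hs
  ext y
  constructor
  · rintro ⟨x, hx, rfl⟩
    simpa [hs'] using hx
  · intro hy
    exact ⟨_, hy, by simp only; field_simp; ring⟩

theorem image_ball {s : ℝ} (hs : 0 < s) (z p : ℂ) :
    (fun x : ℂ => (s : ℂ) * x + z) '' Metric.ball p (1 / 4) =
      Metric.ball (s * p + z) (s / 4) := by
  have hs' : (s : ℂ) ≠ 0 := by exact_mod_cast hs.ne'
  rw [image_affine hs.ne']
  ext y
  rw [mem_ofPred_eq, mem_ball_iff_norm, mem_ball_iff_norm]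
  have : y - (s * p + z) = s * ((y - z) / s - p) := by field_simp; ring
  rw [this, norm_mul, Complex.norm_real, Real.norm_eq_abs, abs_of_pos hs, div_eq_mul_one_div s 4]
  exact (mul_lt_mul_iff_right₀ hs).symm

theorem image_rectH {s : ℝ} (hs : 0 < s) (m : ℂ) :
    (fun x : ℂ => (s : ℂ) * x + (m - s * ⟨3 / 2, 1 / 2⟩)) '' rectH = corridor 1 m s := by
  rw [image_affine hs.ne']
  ext y
  rw [mem_corridor_one, mem_ofPred_eq, rectH, Complex.mem_reProdIm]
  simp only [Complex.div_ofReal_re, Complex.div_ofReal_im, mem_Icc, div_le_iff₀ hs,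
    le_div_iff₀ hs, abs_le, Complex.sub_re, Complex.sub_im, Complex.re_ofReal_mul,
    Complex.im_ofReal_mul]
  constructor
  · rintro ⟨⟨_, _⟩, _, _⟩
    refine ⟨⟨?_, ?_⟩, ?_, ?_⟩ <;> linarith
  · rintro ⟨⟨_, _⟩, _, _⟩
    refine ⟨⟨?_, ?_⟩, ?_, ?_⟩ <;> linarith

theorem image_rectV {s : ℝ} (hs : 0 < s) (m : ℂ) :
    (fun x : ℂ => (s : ℂ) * x + (m - s * ⟨1 / 2, 3 / 2⟩)) '' rectV = corridor Complex.I m s := by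
  rw [image_affine hs.ne']
  ext y
  rw [mem_corridor_I, mem_ofPred_eq, rectV, Complex.mem_reProdIm]
  simp only [Complex.div_ofReal_re, Complex.div_ofReal_im, mem_Icc, div_le_iff₀ hs,
    le_div_iff₀ hs, abs_le, Complex.sub_re, Complex.sub_im, Complex.re_ofReal_mul,
    Complex.im_ofReal_mul]
  constructor
  · rintro ⟨⟨_, _⟩, _, _⟩
    refine ⟨⟨?_, ?_⟩, ?_, ?_⟩ <;> linarith
  · rintro ⟨⟨_, _⟩, _, _⟩
    refine ⟨⟨?_, ?_⟩, ?_, ?_⟩ <;> linarith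

theorem corridor_neg (e m : ℂ) (s : ℝ) : corridor (-e) m s = corridor e m s := by
  simp only [corridor, map_neg, mul_neg, Complex.neg_re, Complex.neg_im, abs_neg]

theorem corridorStart_neg (e m : ℂ) (s : ℝ) : corridorStart (-e) m s = corridorEnd e m s := by
  simp [corridorStart, corridorEnd]

theorem corridorEnd_neg (e m : ℂ) (s : ℝ) : corridorEnd (-e) m s = corridorStart e m s := by
  simp [corridorStart, corridorEnd, sub_eq_add_neg]

theorem _root_.UniformCrossing.exists_crossingEstimate {Γ : ℝ → PlanarGraph}
    (h : UniformCrossing Γ) : ∃ (δ₀ : ℝ) (a : ℝ≥0∞), 0 < δ₀ ∧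
      ∀ δ : ℝ, 0 < δ → δ < δ₀ → (Γ δ).CrossingEstimate (δ / δ₀) a := by
  obtain ⟨δ₀, α₀, hδ₀, hα₀, h⟩ := h
  -- The scales `l * δ` with `l ≥ 1 / δ₀` are those from `δ / δ₀` on. The minimum with `1` ensures
  -- `a ≤ 1`, and the reversed crossings give the directions `-1` and `-I`.
  refine ⟨δ₀, ENNReal.ofReal (min α₀ 1), hδ₀, fun δ hδ hδδ => ⟨by positivity, ?_, ?_, ?_⟩⟩
  · simpa using hα₀
  · simp
  intro e he m s hs v hv hvS
  have hs0 : 0 < s := lt_of_lt_of_le (by positivity) hs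
  have hα : ENNReal.ofReal (min α₀ 1) ≤ ENNReal.ofReal α₀ :=
    ENNReal.ofReal_le_ofReal (min_le_left _ _)
  have hl : 1 / δ₀ ≤ s / δ := by
    rw [le_div_iff₀ hδ]; refine le_trans (le_of_eq ?_) hs; ring
  have hls : s / δ * δ = s := div_mul_cancel₀ _ hδ.ne'
  obtain ⟨h1, h2, -, -⟩ := h δ hδ hδδ (m - s * ⟨3 / 2, 1 / 2⟩) (s / δ) hl
  obtain ⟨-, -, h3, h4⟩ := h δ hδ hδδ (m - s * ⟨1 / 2, 3 / 2⟩) (s / δ) hl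
  rw [Crosses, hls] at h1 h2 h3 h4
  simp only [ballOne, ballRight, ballUp, image_ball hs0, image_rectH hs0, image_rectV hs0]
    at h1 h2 h3 h4
  have e1 : Metric.ball (s * (⟨1 / 2, 1 / 2⟩ : ℂ) + (m - s * ⟨3 / 2, 1 / 2⟩)) (s / 4) =
      corridorStart 1 m s := by
    rw [corridorStart]; congr 1; apply Complex.ext <;> simp; ring
  have e2 : Metric.ball (s * (⟨5 / 2, 1 / 2⟩ : ℂ) + (m - s * ⟨3 / 2, 1 / 2⟩)) (s / 4) =
      corridorEnd 1 m s := by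
    rw [corridorEnd]; congr 1; apply Complex.ext <;> simp; ring
  have e3 : Metric.ball (s * (⟨1 / 2, 1 / 2⟩ : ℂ) + (m - s * ⟨1 / 2, 3 / 2⟩)) (s / 4) =
      corridorStart Complex.I m s := by
    rw [corridorStart]; congr 1; apply Complex.ext <;> simp; ring
  have e4 : Metric.ball (s * (⟨1 / 2, 5 / 2⟩ : ℂ) + (m - s * ⟨1 / 2, 3 / 2⟩)) (s / 4) =
      corridorEnd Complex.I m s := by
    rw [corridorEnd]; congr 1; apply Complex.ext <;> simp; ring
  rw [e1, e2] at h1 h2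
  rw [e3, e4] at h3 h4
  rcases he with rfl | rfl | rfl | rfl
  · exact hα.trans (h1 v hv hvS).le
  · rw [corridorStart_neg] at hvS
    rw [corridorEnd_neg, corridor_neg]
    exact hα.trans (h2 v hv hvS).le
  · exact hα.trans (h3 v hv hvS).le
  · rw [corridorStart_neg] at hvS
    rw [corridorEnd_neg, corridor_neg]
    exact hα.trans (h4 v hv hvS).le

end PlanarGraph

/-! ### Choice of the scales, and the Poisson process -/

/-- The mass of the large loops close to the boundary of a bounded simply connected domain is
small, uniformly in the mesh size. -/
theorem exists_loopMeasureIn_le {D : Set ℂ} (hDo : IsOpen D) (hDs : IsSimplyConnected D)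
    (hDb : Bornology.IsBounded D) {Γ : ℝ → PlanarGraph} (hcross : UniformCrossing Γ) {ε : ℝ}
    (hε : 0 < ε) : ∃ η : ℝ, 0 < η ∧ ∃ δ₁ : ℝ, 0 < δ₁ ∧ ∀ δ : ℝ, 0 < δ → δ < δ₁ →
      (Γ δ).loopMeasureIn D
        (UnrootedLoop.largeMeeting (Metric.thickening η (frontier D)) (ε / 2)) ≤
        ENNReal.ofReal ε := by
  obtain ⟨δ₀, a, hδ₀, hG⟩ := hcross.exists_crossingEstimate
  have hG₀ := hG (δ₀ / 2) (by linarith) (by linarith)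
  have ha : a ^ 82 ≠ 0 := pow_ne_zero _ hG₀.ne_zero
  set r := ε / 60 with hrdef
  have hr : 0 < r := by positivity
  obtain ⟨t, ht, hDt⟩ := Metric.totallyBounded_iff.1 (hDb.isCompact_closure.totallyBounded.subset subset_closure) (r / 2) (by positivity)
  have hF : D ⊆ ⋃ x ∈ ht.toFinset, Metric.closedBall x (r / 2) := by
    refine hDt.trans (iUnion₂_subset fun x hx => ?_)
    exact Metric.ball_subset_closedBall.trans
      (subset_biUnion_of_mem (u := fun x => Metric.closedBall x (r / 2))
        (show x ∈ ht.toFinset by simpa using hx))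
  have hlt : 1 - a ^ 82 < 1 := ENNReal.sub_lt_self ENNReal.one_ne_top one_ne_zero ha
  have hlim := ENNReal.tendsto_pow_atTop_nhds_zero_of_lt_one hlt
  have hlim' : Tendsto (fun k : ℕ => (ht.toFinset.card : ℝ≥0∞) * (2 * (1 - a ^ 82) ^ k / a ^ 82))
      atTop (𝓝 0) := by
    have := ENNReal.Tendsto.const_mul (a := (ht.toFinset.card : ℝ≥0∞)) (ENNReal.Tendsto.div_const
      (ENNReal.Tendsto.const_mul (a := 2) hlim (Or.inr (by simp))) (b := a ^ 82) (Or.inr ha))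
      (Or.inr (by simp))
    simpa using this
  -- The cover and `a` do not depend on `δ`, so neither does the number `k` of scales. Only
  -- afterwards is `δ` made small enough for `640 * (δ / δ₀) ≤ η`.
  obtain ⟨k, hk1, hk2⟩ := ((hlim.eventually_le_const (u := 1 / 2) (by simp)).and
    (hlim'.eventually_le_const (u := ENNReal.ofReal ε) (by simpa using hε))).exists
  have hη : 0 < r / (4 * 32 ^ k) := by positivity
  refine ⟨r / (4 * 32 ^ k), hη, min δ₀ (r / (4 * 32 ^ k) * δ₀ / 640), by positivity, ?_⟩
  intro δ hδ hδ₁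
  have h1 := hδ₁.trans_le (min_le_left _ _)
  have h2 := hδ₁.trans_le (min_le_right _ _)
  have h3 := (hG δ hδ h1).loopMeasureIn_le hDo hDs hF rfl (k := k) (by
    rw [← mul_div_assoc, div_le_iff₀ hδ₀]; linarith) rfl hk1
  rw [show 30 * r = ε / 2 by rw [hrdef]; ring] at h3
  exact h3.trans hk2

/-- A Poisson point process has no point in a set of small intensity, with large probability. -/
theorem IsPoissonPointProcess.le_prob_of_le {X Ω : Type*} [MeasurableSpace X] [MeasurableSpace Ω]
    {μ : Measure X} {P : Measure Ω} {L : Ω → X → ℕ∞} (h : IsPoissonPointProcess μ P L) {A : Set X}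
    (hA : MeasurableSet A) {ε : ℝ} (hε : 0 ≤ ε) (hμ : μ A ≤ ENNReal.ofReal ε) :
    ENNReal.ofReal (1 - ε) ≤ P {ω | ∀ x ∈ A, L ω x = 0} := by
  have hfin : μ A ≠ ∞ := ne_top_of_le_ne_top ENNReal.ofReal_ne_top hμ
  have hP := h.poisson A hA hfin 0
  have hle : (μ A).toReal ≤ ε := ENNReal.toReal_le_of_le_ofReal hε hμ
  -- The probability of no point is `exp (-μ A)`, and `1 - x ≤ exp (-x)`.
  calc ENNReal.ofReal (1 - ε) ≤ ENNReal.ofReal (Real.exp (-(μ A).toReal)) := by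
        refine ENNReal.ofReal_le_ofReal ?_
        linarith [Real.add_one_le_exp (-(μ A).toReal)]
    _ = P {ω | multisetCount (L ω) A = (0 : ℕ)} := by rw [hP]; simp
    _ ≤ _ := by
        refine measure_mono fun ω hω x hx => ?_
        simp only [mem_ofPred_eq, multisetCount, Nat.cast_zero, ENNReal.tsum_eq_zero] at hω
        simpa using hω ⟨x, hx⟩

end

theorem corollary4p2 (D : Set ℂ) (hDo : IsOpen D) (hDs : IsSimplyConnected D)
    (hDb : Bornology.IsBounded D) (Γ : ℝ → PlanarGraph) (hdens : BoundedDensity Γ)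
    (hcross : UniformCrossing Γ) :
    (∀ ε : ℝ, 0 < ε → ∃ η : ℝ, 0 < η ∧ ∃ δ₁ : ℝ, 0 < δ₁ ∧ ∀ δ : ℝ, 0 < δ → δ < δ₁ →
      ∀ (Ω : Type*) [MeasurableSpace Ω] (P : Measure Ω) [IsProbabilityMeasure P]
        (L : Ω → UnrootedLoop → ℕ∞), IsPoissonPointProcess ((Γ δ).loopMeasureIn D) P L →
        ENNReal.ofReal (1 - ε) ≤
          P {ω | ¬ ∃ l : UnrootedLoop, L ω l ≠ 0 ∧
            (l.trace ∩ Metric.thickening η (frontier D)).Nonempty ∧ ε < Metric.diam l.trace}) ∧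
    (∀ ε : ℝ, 0 < ε → ∃ η' : ℝ, 0 < η' ∧ ∃ δ₁ : ℝ, 0 < δ₁ ∧ ∀ δ : ℝ, 0 < δ → δ < δ₁ →
      (Γ δ).loopMeasureIn D {l | l ∈ loopsIn D ∧ ε ≤ Metric.diam l.trace ∧
        (l.trace ∩ Metric.thickening η' (frontier D)).Nonempty} ≤ ENNReal.ofReal ε) := by
  refine ⟨fun ε hε => ?_, fun ε hε => ?_⟩
  · obtain ⟨η, hη, δ₁, hδ₁, h⟩ := exists_loopMeasureIn_le hDo hDs hDb hcross hε
    refine ⟨η, hη, δ₁, hδ₁, fun δ hδ hδδ Ω _ P _ L hL => ?_⟩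
    refine (hL.le_prob_of_le
      (UnrootedLoop.measurableSet_largeMeeting Metric.isOpen_thickening _) hε.le
      (h δ hδ hδδ)).trans (measure_mono fun ω hω => ?_)
    rintro ⟨l, hl, hmeet, hdiam⟩
    exact hl (hω l ⟨hmeet, UnrootedLoop.exists_lt_dist_of_lt_diam (by linarith) (by linarith)⟩)
  · obtain ⟨η, hη, δ₁, hδ₁, h⟩ := exists_loopMeasureIn_le hDo hDs hDb hcross hε
    refine ⟨η, hη, δ₁, hδ₁, fun δ hδ hδδ => le_trans (measure_mono ?_) (h δ hδ hδδ)⟩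
    rintro l ⟨-, hdiam, hmeet⟩
    -- The threshold `ε / 2 < ε` turns the bound on the diameter into two points at distance
    -- strictly larger than the threshold.
    exact ⟨hmeet, UnrootedLoop.exists_lt_dist_of_lt_diam (by linarith) (by linarith)⟩
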